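/- **Setting.** Let $\mathcal X$ be a set (the data universe), let $p\ge 0$ be an integer, let $\mathcal C\subset\mathbb R^p$ be a nonempty, closed, bounded, convex set with Euclidean diameter $\|\mathcal C\|_2$, and let $L\ge 0$. For every $d\in\mathcal X$ let $\ell(\cdot;d)$ be convex and $L$-Lipschitz on $\mathcal C$. For $\theta\in\mathcal C$ let $\nabla\ell(\theta;d)$ be a choice, measurable in $\theta$, of a subgradient of $\ell(\cdot;d)$ at $\theta$, that is, a vector $z$ with $\ell(y;d)\ge\ell(\theta;d)+\langle z,y-\theta\rangle$ for all $y\in\mathcal C$; on the boundary of $\mathcal C$ it is chosen with $\|\nabla\ell(\theta;d)\|_2\le L$ (at interior points this bound is automatic). For a data set $\mathcal D=(d_1,\dots,d_n)\in\mathcal X^n$ put $\mathcal L(\theta;\mathcal D)=\sum_{i=1}^n\ell(\theta;d_i)$. Two data sets are neighbors if they differ in exactly one entry. A randomized algorithm $\mathcal A$ is $(\epsilon,\delta)$-differentially private if $\Pr(\mathcal A(\mathcal D)\in S)\le e^{\epsilon}\Pr(\mathcal A(\mathcal D')\in S)+\delta$ for all neighbors $\mathcal D,\mathcal D'$ and all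 measurable $S$. Throughout, $0<\delta<1$ and $0<\epsilon\le 2\sqrt{\log(1/\delta)}$. **Algorithm.** Given a noise level $\sigma^2\ge0$, a learning rate $\eta:\{1,2,\dots\}\to\mathbb R$ and a starting point $\theta_1\in\mathcal C$ that does not depend on the data, for $t=1,\dots,n^2-1$ draw $d$ uniformly from the $n$ entries of $\mathcal D$ and, independently, $b_t\sim\mathcal N(0,\sigma^2\mathbb I_p)$, all draws being independent of the past, and set $$\theta_{t+1}=\Pi_{\mathcal C}\bigl(\theta_t-\eta(t)\,[\,n\nabla\ell(\theta_t;d)+b_t\,]\bigr),$$ where $\Pi_{\mathcal C}$ is the Euclidean projection onto $\mathcal C$. Output $\theta^{priv}=\theta_{n^2}$. **Theorem.** 1. (Privacy.) If $\sigma^2=\dfrac{32L^2n^2\log(n/\delta)\log(1/\delta)}{\epsilon^2}$, then for every learning rate $\eta$ and every $\theta_1\in\mathcal C$ the algorithm is $(\epsilon,\delta)$-differentially private. 2. (Utility.) For every $K$ there is a constant $c>0$, depending on $K$ only, such that the following holds whenever $n\ge2$ and $0\le\sigma^2\le K\,\dfrac{L^2n^2\log(n/\delta)\log(1/\delta)}{\epsilon^2}$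 (in particular, with $K=32$, for the variance in part 1), for every $\theta_1\in\mathcal C$, every $\mathcal D\in\mathcal X^n$ and every minimizer $\theta^*$ of $\mathcal L(\cdot;\mathcal D)$ over $\mathcal C$. The expectations are over the randomness of the algorithm, and the random variables in them are integrable. (a) With $\eta(t)=\dfrac{\|\mathcal C\|_2}{\sqrt{t\,(n^2L^2+p\sigma^2)}}$ (read as $0$ if the denominator vanishes), $$\mathbb E\bigl[\mathcal L(\theta^{priv};\mathcal D)-\mathcal L(\theta^*;\mathcal D)\bigr]\le c\,\frac{L\|\mathcal C\|_2\log^{3/2}(n/\delta)\sqrt{p\log(1/\delta)}}{\epsilon}.$$ (b) If moreover, for some $\Delta>0$, every $\ell(\cdot;d)$ is $\Delta$-strongly convex on $\mathcal C$, meaning that $\ell(y;d)\ge\ell(x;d)+\langle z,y-x\rangle+\frac{\Delta}{2}\|y-x\|_2^2$ for all $x,y\in\mathcal C$ and all subgradients $z$ at $x$, then with $\eta(t)=\dfrac1{\Delta nt}$, $$\mathbb E\bigl[\mathcal L(\theta^{priv};\mathcal D)-\mathcal L(\theta^*;\mathcal D)\bigr]\le c\,\frac{L^2\log^2(n/\delta)\,p\log(1/\delta)}{n\Delta\epsilon^2}.$$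 -/

import Mathlib

open MeasureTheory ProbabilityTheory
open scoped NNReal ENNReal

noncomputable section

namespace NoisyGD

/-- The parameter space `ℝ^p` with the Euclidean norm. -/
abbrev Param (p : ℕ) : Type := EuclideanSpace ℝ (Fin p)

/-! ### Differential privacy -/

/-- Two data sets of size `n` are neighbors if they differ in exactly one entry. -/
def Neighbors {X : Type*} {n : ℕ} (D D' : Fin n → X) : Prop :=
  ∃ i, D i ≠ D' i ∧ ∀ j, j ≠ i → D j = D' j

/-- A randomized algorithm, given by the law `M D` of its output on each data set `D`, is
`(ε, δ)`-differentially private. -/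
def IsDifferentiallyPrivate {X Θ : Type*} [MeasurableSpace Θ] {n : ℕ}
    (M : (Fin n → X) → Measure Θ) (ε δ : ℝ) : Prop :=
  ∀ D D' : Fin n → X, Neighbors D D' → ∀ S : Set Θ, MeasurableSet S →
    M D S ≤ ENNReal.ofReal (Real.exp ε) * M D' S + ENNReal.ofReal δ

/-! ### Convex empirical risk minimization -/

/-- The empirical risk `𝓛(θ; D) = ∑ i, ℓ(θ; d_i)`. -/
def empiricalRisk {X : Type*} {p n : ℕ} (loss : Param p → X → ℝ) (D : Fin n → X)
    (θ : Param p) : ℝ :=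
  ∑ i, loss θ (D i)

/-- `z` is a subgradient of `f` at `x`, where `f` is regarded as a function on `C`. -/
def IsSubgradientAt {p : ℕ} (C : Set (Param p)) (f : Param p → ℝ) (x z : Param p) : Prop :=
  ∀ y ∈ C, f x + inner ℝ z (y - x) ≤ f y

/-- `f` is `Δ`-strongly convex on `C`: at every point and for every subgradient there, `f` is
bounded below by the tangent quadratic function with leading coefficient `Δ / 2`. -/
def IsStronglyConvex {p : ℕ} (C : Set (Param p)) (Δ : ℝ) (f : Param p → ℝ) : Prop :=
  ∀ x ∈ C, ∀ z, IsSubgradientAt C f x z →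
    ∀ y ∈ C, f x + inner ℝ z (y - x) + Δ / 2 * ‖y - x‖ ^ 2 ≤ f y

/-- The setting: `C` is a nonempty, closed, bounded, convex set, every `ℓ(·; d)` is convex and
`L`-Lipschitz on `C`, and `grad θ d` is a (measurable) choice of a subgradient of `ℓ(·; d)` at
each `θ ∈ C`. The subgradients are to have norm at most `L`; at interior points of `C` this
follows from the Lipschitz condition, so it is required on the boundary only. -/
structure IsLipschitzERM {X : Type*} {p : ℕ} (C : Set (Param p)) (L : ℝ≥0)
    (loss : Param p → X → ℝ) (grad : Param p → X → Param p) : Prop where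
  nonempty : C.Nonempty
  isClosed : IsClosed C
  isBounded : Bornology.IsBounded C
  convex : Convex ℝ C
  convexOn : ∀ d, ConvexOn ℝ C fun θ => loss θ d
  lipschitzOn : ∀ d, LipschitzOnWith L (fun θ => loss θ d) C
  measurable_grad : ∀ d, Measurable fun θ => grad θ d
  isSubgradient : ∀ d, ∀ θ ∈ C, IsSubgradientAt C (fun θ' => loss θ' d) θ (grad θ d)
  norm_grad_le : ∀ d, ∀ θ ∈ frontier C, ‖grad θ d‖ ≤ L

/-! ### The algorithm -/

/-- The Euclidean projection `Π_C(x) = argmin_{y ∈ C} ‖x - y‖`. -/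
def proj {p : ℕ} (C : Set (Param p)) (x : Param p) : Param p :=
  Classical.epsilon fun y => y ∈ C ∧ ∀ y' ∈ C, ‖x - y‖ ≤ ‖x - y'‖

/-- The noise distribution `N(0, σ² I_p)`, with `σsq` standing for `σ²`. -/
def noise (p : ℕ) (σsq : ℝ) : Measure (Param p) :=
  multivariateGaussian 0 (σsq • (1 : Matrix (Fin p) (Fin p) ℝ))

/-- The law of the iterate that follows `θ` when the learning rate is `η`: draw `i` uniformly from
`Fin n` and, independently, `b` from `N(0, σ² I_p)`, and return
`Π_C(θ - η (n ∇ℓ(θ; d_i) + b))`. -/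
def stepLaw {X : Type*} {p n : ℕ} (C : Set (Param p)) (grad : Param p → X → Param p) (σsq : ℝ)
    (D : Fin n → X) (η : ℝ) (θ : Param p) : Measure (Param p) :=
  ((uniformOn (Set.univ : Set (Fin n))).prod (noise p σsq)).map
    fun ib => proj C (θ - η • ((n : ℝ) • grad θ (D ib.1) + ib.2))

/-- The law of the iterate `θ_{k+1}`, that is, after the updates `t = 1, …, k`, when the algorithm
is started at `θ₁` and run with fresh randomness in every step. -/
def iterateLaw {X : Type*} {p n : ℕ} (C : Set (Param p)) (grad : Param p → X → Param p)
    (σsq : ℝ) (η : ℕ → ℝ) (θ₁ : Param p) (D : Fin n → X) : ℕ → Measure (Param p)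
  | 0 => Measure.dirac θ₁
  | k + 1 => (iterateLaw C grad σsq η θ₁ D k).bind (stepLaw C grad σsq D (η (k + 1)))

/-- The law of the output `θ^priv = θ_{n²}`, obtained by the updates `t = 1, …, n² - 1`. -/
def outputLaw {X : Type*} {p n : ℕ} (C : Set (Param p)) (grad : Param p → X → Param p)
    (σsq : ℝ) (η : ℕ → ℝ) (θ₁ : Param p) (D : Fin n → X) : Measure (Param p) :=
  iterateLaw C grad σsq η θ₁ D (n ^ 2 - 1)

/-- The order of magnitude `L² n² log(n/δ) log(1/δ) / ε²` of the noise variance. -/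
def varianceScale (L : ℝ≥0) (n : ℕ) (ε δ : ℝ) : ℝ :=
  (L : ℝ) ^ 2 * n ^ 2 * Real.log (n / δ) * Real.log (1 / δ) / ε ^ 2

/-- The learning rate `η(t) = ‖C‖ / √(t (n² L² + p σ²))`, where `‖C‖` is the diameter of `C`. -/
def lipschitzRate {p : ℕ} (C : Set (Param p)) (L : ℝ≥0) (n : ℕ) (σsq : ℝ) (t : ℕ) : ℝ :=
  Metric.diam C / Real.sqrt (t * ((n : ℝ) ^ 2 * (L : ℝ) ^ 2 + p * σsq))

/-- The learning rate `η(t) = 1 / (Δ n t)`. -/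
def stronglyConvexRate (Δ : ℝ) (n : ℕ) (t : ℕ) : ℝ :=
  1 / (Δ * n * t)

/-- The standing conditions on the privacy parameters. -/
def AdmissiblePrivacy (ε δ : ℝ) : Prop :=
  0 < δ ∧ δ < 1 ∧ 0 < ε ∧ ε ≤ 2 * Real.sqrt (Real.log (1 / δ))

end NoisyGD

end

/-! Privacy. After rescaling by σ, one update from θ is a data-independent map applied to a draw
from the uniform mixture of unit Gaussians with centers `v j = (n / σ) ∇ℓ(θ; d_j)`, and passing to a
neighboring data set moves one center. Let `P`, `Q` be the two mixture densities. In `∫ P ^ a * Q ^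
(1 - a)`, expand `(P / Q) ^ a` to second order at `1`: the linear term integrates to zero, and the
quadratic one contains `(P - Q) ^ 2`, which is `1 / n ^ 2` times the square of a difference of two
single Gaussian densities. Hence the moment is at most `1 + K / n ^ 2` with `K ≤ 1.3`
(`lintegral_mixture_rpow_le`, `lintegral_mixture_two_le`). This gain from subsampling balances the
`n ^ 2 - 1` updates: the composed moment stays below `4`. Moment bounds are carried in the dual form
`HolderDominated`, which passes through maps and kernels at once, and `HolderDominated.measure_le`
turns the final one into the `(ε, δ)` inequality. The order must satisfy `(a - 1) ε ≥ log (1 / δ)`: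
it is `1 + log (1 / δ) / ε` for small `ε` and `2` otherwise.

Utility. Nonexpansiveness of the projection and centered noise give the usual one-step inequality
for the expected squared distance to any comparator in `C` (`integral_projStep_norm_sq_le`).
Telescoping bounds sums of expected excess risks. By the Markov property the same bound holds from
the iterate at time `j`, with that iterate itself as comparator, so later risks exceed the risk at
time `j` only slightly on average. `last_le_average_add` converts this into a bound on the last
iterate at the price of a logarithm, and `second_moment_le` inserts the size of the noise. -/

noncomputable section

namespace NoisyGD

/-! ### Euclidean projection -/

section Projection

variable {p : ℕ} {C : Set (Param p)}

lemma proj_spec (hne : C.Nonempty) (hcl : IsClosed C) (x : Param p) :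
    proj C x ∈ C ∧ ∀ y ∈ C, ‖x - proj C x‖ ≤ ‖x - y‖ := by
  obtain ⟨y, hy, h⟩ := hcl.exists_infDist_eq_dist hne x
  refine Classical.epsilon_spec
    (p := fun y => y ∈ C ∧ ∀ y' ∈ C, ‖x - y‖ ≤ ‖x - y'‖) ⟨y, hy, fun z hz => ?_⟩
  rw [← dist_eq_norm, ← dist_eq_norm, ← h]
  exact Metric.infDist_le_dist_of_mem hz

lemma proj_mem (hne : C.Nonempty) (hcl : IsClosed C) (x : Param p) : proj C x ∈ C :=
  (proj_spec hne hcl x).1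

lemma inner_sub_proj_le_zero (hne : C.Nonempty) (hcl : IsClosed C) (hcv : Convex ℝ C)
    (x : Param p) {y : Param p} (hy : y ∈ C) : inner ℝ (x - proj C x) (y - proj C x) ≤ 0 := by
  obtain ⟨hm, hmin⟩ := proj_spec hne hcl x
  refine (norm_eq_iInf_iff_real_inner_le_zero hcv hm).1 ?_ y hy
  have : Nonempty C := hne.to_subtype
  refine le_antisymm (le_ciInf fun w => hmin w w.2) ?_
  exact ciInf_le ⟨0, by rintro _ ⟨w, rfl⟩; exact norm_nonneg _⟩ (⟨_, hm⟩ : C)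

lemma norm_proj_sub_proj_le (hne : C.Nonempty) (hcl : IsClosed C) (hcv : Convex ℝ C)
    (x y : Param p) : ‖proj C x - proj C y‖ ≤ ‖x - y‖ := by
  have h1 := inner_sub_proj_le_zero hne hcl hcv x (proj_mem hne hcl y)
  have h2 := inner_sub_proj_le_zero hne hcl hcv y (proj_mem hne hcl x)
  have h3 : ‖proj C x - proj C y‖ ^ 2 ≤ inner ℝ (x - y) (proj C x - proj C y) := by
    rw [← real_inner_self_eq_norm_sq]
    have e1 : inner ℝ (x - proj C x) (proj C y - proj C x)
        = - inner ℝ (x - proj C x) (proj C x - proj C y) := by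
      rw [← inner_neg_right, neg_sub]
    have e2 : inner ℝ (x - y) (proj C x - proj C y)
        - inner ℝ (proj C x - proj C y) (proj C x - proj C y)
        = inner ℝ (x - proj C x) (proj C x - proj C y)
          - inner ℝ (y - proj C y) (proj C x - proj C y) := by
      rw [← inner_sub_left, ← inner_sub_left]; congr 1; abel
    linarith
  have h4 := real_inner_le_norm (x - y) (proj C x - proj C y)
  by_contra! h
  have h5 : 0 < ‖proj C x - proj C y‖ := (norm_nonneg _).trans_lt h
  nlinarith

lemma continuous_proj (hne : C.Nonempty) (hcl : IsClosed C) (hcv : Convex ℝ C) :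
    Continuous (proj C) :=
  (LipschitzWith.of_dist_le_mul (K := 1) fun x y => by
    simpa [dist_eq_norm] using norm_proj_sub_proj_le hne hcl hcv x y).continuous

lemma proj_eq_self (hcl : IsClosed C) {x : Param p} (hx : x ∈ C) : proj C x = x := by
  have := (proj_spec ⟨x, hx⟩ hcl x).2 x hx
  rw [sub_self, norm_zero] at this
  exact (sub_eq_zero.1 (norm_le_zero_iff.1 this)).symm

lemma norm_proj_sub_le (hcl : IsClosed C) (hcv : Convex ℝ C)
    (x : Param p) {z : Param p} (hz : z ∈ C) : ‖proj C x - z‖ ≤ ‖x - z‖ := by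
  simpa [proj_eq_self hcl hz] using norm_proj_sub_proj_le ⟨z, hz⟩ hcl hcv x z

end Projection

/-! ### Subgradients in the Lipschitz setting -/

section Setting

variable {X : Type*} {p n : ℕ} {C : Set (Param p)} {L : ℝ≥0}
  {loss : Param p → X → ℝ} {grad : Param p → X → Param p}

/-- Moving from `x` by a small multiple `t • z` raises `f` by at least `t ‖z‖ ^ 2`, whereas the
Lipschitz condition allows at most `L t ‖z‖`. -/
lemma IsSubgradientAt.norm_le_of_mem_interior {f : Param p → ℝ} (hf : LipschitzOnWith L f C)
    {x z : Param p} (hx : x ∈ interior C) (hz : IsSubgradientAt C f x z) : ‖z‖ ≤ L := by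
  obtain ⟨r, hr, hball⟩ := Metric.mem_nhds_iff.1 (mem_interior_iff_mem_nhds.1 hx)
  by_cases h0 : z = 0
  · simp [h0]
  have hz0 : 0 < ‖z‖ := norm_pos_iff.2 h0
  set t : ℝ := r / (2 * ‖z‖) with ht
  have ht0 : 0 < t := by positivity
  have hn : ‖t • z‖ = t * ‖z‖ := by rw [norm_smul, Real.norm_of_nonneg ht0.le]
  have hmem : x + t • z ∈ C := by
    apply hball
    rw [Metric.mem_ball, dist_eq_norm, add_sub_cancel_left, hn, ht]
    field_simp
    linarith
  have h1 := hz _ hmem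
  have h2 := hf.dist_le_mul _ hmem _ (interior_subset hx)
  rw [add_sub_cancel_left, real_inner_smul_right, real_inner_self_eq_norm_sq] at h1
  rw [Real.dist_eq, dist_eq_norm, add_sub_cancel_left, hn] at h2
  have h3 := (le_abs_self _).trans h2
  have h4 : t * ‖z‖ * ‖z‖ ≤ t * ‖z‖ * L := by nlinarith
  exact le_of_mul_le_mul_left h4 (by positivity)

lemma IsLipschitzERM.norm_grad_le_of_mem (h : IsLipschitzERM C L loss grad) (d : X)
    {θ : Param p} (hθ : θ ∈ C) : ‖grad θ d‖ ≤ L := by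
  by_cases hi : θ ∈ interior C
  · exact (h.isSubgradient d θ hθ).norm_le_of_mem_interior (h.lipschitzOn d) hi
  · exact h.norm_grad_le d θ ⟨subset_closure hθ, hi⟩

/-! ### The iterates stay in the constraint set -/

/-- The transition kernel of the algorithm, precomposed with the projection so that its values
off `C` are irrelevant. -/
def projStep (C : Set (Param p)) (grad : Param p → X → Param p) (σsq : ℝ) (D : Fin n → X)
    (η : ℝ) (θ : Param p) : Measure (Param p) :=
  stepLaw C grad σsq D η (proj C θ)

instance (σsq : ℝ) : IsProbabilityMeasure (noise p σsq) := by
  unfold noise; infer_instance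

/-- One update, as a function of the current iterate, the sampled index and the noise. -/
def stepMap (C : Set (Param p)) (grad : Param p → X → Param p) (D : Fin n → X) (η : ℝ)
    (q : Param p × (Fin n × Param p)) : Param p :=
  proj C (proj C q.1 - η • ((n : ℝ) • grad (proj C q.1) (D q.2.1) + q.2.2))

lemma measurable_grad_proj (h : IsLipschitzERM C L loss grad) (D : Fin n → X) :
    Measurable fun q : Param p × Fin n => grad (proj C q.1) (D q.2) :=
  measurable_from_prod_countable_left fun i => (h.measurable_grad (D i)).comp
    (continuous_proj h.nonempty h.isClosed h.convex).measurable

lemma measurable_stepMap (h : IsLipschitzERM C L loss grad) (D : Fin n → X) (η : ℝ) :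
    Measurable (stepMap C grad D η) := by
  have hp : Measurable (proj C) := (continuous_proj h.nonempty h.isClosed h.convex).measurable
  have hg' : Measurable fun q : Param p × (Fin n × Param p) => grad (proj C q.1) (D q.2.1) := by
    have := (measurable_grad_proj h D).comp
      (measurable_fst.prodMk (measurable_fst.comp measurable_snd) :
        Measurable fun q : Param p × (Fin n × Param p) => (q.1, q.2.1))
    exact this
  have hb : Measurable fun q : Param p × (Fin n × Param p) => q.2.2 :=
    measurable_snd.comp measurable_snd
  have h1 := (hg'.const_smul (n : ℝ)).add hb
  have h2 := (hp.comp measurable_fst).sub (h1.const_smul η)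
  exact hp.comp h2

instance [NeZero n] : IsProbabilityMeasure (uniformOn (Set.univ : Set (Fin n))) :=
  isProbabilityMeasure_uniformOn Set.finite_univ Set.univ_nonempty

lemma projStep_eq_map (σsq : ℝ) (D : Fin n → X) (η : ℝ) (θ : Param p) :
    projStep C grad σsq D η θ = ((uniformOn (Set.univ : Set (Fin n))).prod (noise p σsq)).map
      fun ib => stepMap C grad D η (θ, ib) := rfl

lemma measurable_projStep [NeZero n] (h : IsLipschitzERM C L loss grad) (σsq : ℝ)
    (D : Fin n → X) (η : ℝ) : Measurable (projStep C grad σsq D η) := by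
  have hm := measurable_stepMap h D η
  refine Measure.measurable_of_measurable_coe _ fun s hs => ?_
  have : (fun θ => projStep C grad σsq D η θ s) = fun θ =>
      ((uniformOn (Set.univ : Set (Fin n))).prod (noise p σsq))
        (Prod.mk θ ⁻¹' (stepMap C grad D η ⁻¹' s)) := by
    funext θ
    have hm' : Measurable fun ib => stepMap C grad D η (θ, ib) := hm.comp measurable_prodMk_left
    rw [projStep_eq_map, Measure.map_apply hm' hs]
    rfl
  rw [this]
  exact measurable_measure_prodMk_left (hm hs)

lemma isProbabilityMeasure_projStep [NeZero n] (h : IsLipschitzERM C L loss grad) (σsq : ℝ)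
    (D : Fin n → X) (η : ℝ) (θ : Param p) : IsProbabilityMeasure (projStep C grad σsq D η θ) :=
  Measure.isProbabilityMeasure_map
    ((measurable_stepMap h D η).comp measurable_prodMk_left).aemeasurable

lemma ae_mem_projStep (h : IsLipschitzERM C L loss grad) (σsq : ℝ)
    (D : Fin n → X) (η : ℝ) (θ : Param p) : ∀ᵐ y ∂(projStep C grad σsq D η θ), y ∈ C := by
  have hm' : Measurable fun ib => stepMap C grad D η (θ, ib) :=
    (measurable_stepMap h D η).comp measurable_prodMk_left
  rw [projStep_eq_map]
  refine (ae_map_iff (p := fun y => y ∈ C) hm'.aemeasurable h.isClosed.measurableSet).2 ?_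
  exact Filter.Eventually.of_forall fun ib => proj_mem h.nonempty h.isClosed _

/-- The law of the iterate that is reached from `θ` after `k` updates by `projStep`. -/
def chainLaw (C : Set (Param p)) (grad : Param p → X → Param p)
    (σsq : ℝ) (η : ℕ → ℝ) (D : Fin n → X) (θ : Param p) : ℕ → Measure (Param p)
  | 0 => Measure.dirac θ
  | k + 1 => (chainLaw C grad σsq η D θ k).bind (projStep C grad σsq D (η (k + 1)))

lemma ae_mem_chainLaw [NeZero n] (h : IsLipschitzERM C L loss grad) (σsq : ℝ) (η : ℕ → ℝ)
    (D : Fin n → X) {θ : Param p} (hθ : θ ∈ C) (k : ℕ) :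
    ∀ᵐ y ∂(chainLaw C grad σsq η D θ k), y ∈ C := by
  cases k with
  | zero => simpa [chainLaw, ae_dirac_iff h.isClosed.measurableSet] using hθ
  | succ k =>
    change (chainLaw C grad σsq η D θ (k + 1)) Cᶜ = 0
    rw [chainLaw, Measure.bind_apply h.isClosed.measurableSet.compl
      (measurable_projStep h σsq D _).aemeasurable]
    have : ∀ y, projStep C grad σsq D (η (k + 1)) y Cᶜ = 0 := ae_mem_projStep h σsq D _
    simp [this]

lemma iterateLaw_eq_chainLaw [NeZero n] (h : IsLipschitzERM C L loss grad) (σsq : ℝ)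
    (η : ℕ → ℝ) (D : Fin n → X) {θ : Param p} (hθ : θ ∈ C) (k : ℕ) :
    iterateLaw C grad σsq η θ D k = chainLaw C grad σsq η D θ k := by
  induction k with
  | zero => rfl
  | succ k ih =>
    rw [iterateLaw, chainLaw, ih]
    refine Measure.bind_congr_right ?_
    filter_upwards [ae_mem_chainLaw h σsq η D hθ k] with y hy
    rw [projStep, proj_eq_self h.isClosed hy]

lemma measurable_chainLaw [NeZero n] (h : IsLipschitzERM C L loss grad) (σsq : ℝ)
    (η : ℕ → ℝ) (D : Fin n → X) (k : ℕ) :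
    Measurable fun θ => chainLaw C grad σsq η D θ k := by
  induction k with
  | zero => exact Measure.measurable_dirac
  | succ k ih => exact (Measure.measurable_bind' (measurable_projStep h σsq D _)).comp ih

lemma isProbabilityMeasure_chainLaw [NeZero n] (h : IsLipschitzERM C L loss grad) (σsq : ℝ)
    (η : ℕ → ℝ) (D : Fin n → X) (θ : Param p) (k : ℕ) :
    IsProbabilityMeasure (chainLaw C grad σsq η D θ k) := by
  induction k with
  | zero => exact Measure.dirac.isProbabilityMeasure
  | succ k ih =>
    constructor
    have := fun y => (isProbabilityMeasure_projStep h σsq D (η (k + 1)) y).measure_univ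
    rw [chainLaw, Measure.bind_apply .univ (measurable_projStep h σsq D _).aemeasurable]
    simp [this]

/-- The Markov property: running `j + k` updates amounts to running `j` updates and then `k`
updates with the shifted learning rate. -/
lemma chainLaw_add [NeZero n] (h : IsLipschitzERM C L loss grad) (σsq : ℝ)
    (η : ℕ → ℝ) (D : Fin n → X) (θ : Param p) (j k : ℕ) :
    chainLaw C grad σsq η D θ (j + k) = (chainLaw C grad σsq η D θ j).bind
      fun w => chainLaw C grad σsq (fun i => η (j + i)) D w k := by
  induction k with
  | zero => exact Measure.bind_dirac.symm
  | succ k ih =>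
    rw [← add_assoc, chainLaw, ih, Measure.bind_bind
      (measurable_chainLaw h σsq _ D k).aemeasurable
      (measurable_projStep h σsq D _).aemeasurable]
    rfl

end Setting

/-! ### Gaussian measures -/

section Gaussian

variable {p : ℕ}

/-- Complex exponents are needed because the Cameron–Martin formula below is checked on
characteristic functions, where the density adds a real part to the imaginary exponent. -/
lemma integral_cexp_sum_stdGaussian (z : Fin p → ℂ) :
    ∫ x, Complex.exp (∑ i, z i * (x i : ℂ)) ∂(stdGaussian (Param p)) =
      Complex.exp (∑ i, z i ^ 2 / 2) := by
  rw [← map_pi_eq_stdGaussian, integral_map (by fun_prop) (by fun_prop)]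
  simp_rw [Complex.exp_sum]
  rw [integral_fintype_prod_eq_prod (f := fun i (x : ℝ) => Complex.exp (z i * (x : ℂ)))]
  refine Finset.prod_congr rfl fun i _ => ?_
  have := complexMGF_id_gaussianReal (μ := 0) (v := 1) (z i)
  simpa [complexMGF] using this

lemma integrable_exp_inner_stdGaussian (w : Param p) :
    Integrable (fun x => Real.exp (inner ℝ w x)) (stdGaussian (Param p)) := by
  have h : Integrable (fun x : ℝ => Real.exp x) ((stdGaussian (Param p)).map (innerSL ℝ w)) := by
    rw [IsGaussian.map_eq_gaussianReal]
    simpa using integrable_exp_mul_gaussianReal (1 : ℝ)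
  exact h.comp_measurable (by fun_prop)

lemma integral_exp_inner_stdGaussian (w : Param p) :
    ∫ x, Real.exp (inner ℝ w x) ∂(stdGaussian (Param p)) = Real.exp (‖w‖ ^ 2 / 2) := by
  have h := integral_cexp_sum_stdGaussian (p := p) fun i => (w i : ℂ)
  have e : ∀ x : Param p, Complex.exp (∑ i, (w i : ℂ) * (x i : ℂ)) =
      ((Real.exp (inner ℝ w x) : ℝ) : ℂ) := fun x => by
    simp [PiLp.inner_apply, mul_comm]
  simp_rw [e] at h
  rw [integral_complex_ofReal] at h
  have e2 : Complex.exp (∑ i, (w i : ℂ) ^ 2 / 2) = ((Real.exp (‖w‖ ^ 2 / 2) : ℝ) : ℂ) := by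
    simp [EuclideanSpace.real_norm_sq_eq, Finset.sum_div]
  rw [e2] at h
  exact_mod_cast h

/-- The density of the Gaussian `N(w, 1)` with respect to the standard Gaussian. -/
def gaussianShift (w x : Param p) : ℝ := Real.exp (inner ℝ w x - ‖w‖ ^ 2 / 2)

lemma gaussianShift_pos (w x : Param p) : 0 < gaussianShift w x := Real.exp_pos _

lemma continuous_gaussianShift (w : Param p) : Continuous (gaussianShift w) := by
  unfold gaussianShift; fun_prop

lemma integrable_gaussianShift (w : Param p) :
    Integrable (gaussianShift w) (stdGaussian (Param p)) := by
  unfold gaussianShift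
  simpa only [Real.exp_sub] using
    (integrable_exp_inner_stdGaussian w).div_const (Real.exp (‖w‖ ^ 2 / 2))

lemma integral_gaussianShift (w : Param p) :
    ∫ x, gaussianShift w x ∂(stdGaussian (Param p)) = 1 := by
  simp only [gaussianShift, Real.exp_sub]
  rw [integral_div, integral_exp_inner_stdGaussian, div_self (Real.exp_pos _).ne']

/-- The Cameron–Martin formula in finite dimension. -/
lemma map_add_stdGaussian (w : Param p) :
    (stdGaussian (Param p)).map (fun x => w + x) =
      (stdGaussian (Param p)).withDensity fun x => ENNReal.ofReal (gaussianShift w x) := by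
  have hfin : IsFiniteMeasure
      ((stdGaussian (Param p)).withDensity fun x => ENNReal.ofReal (gaussianShift w x)) :=
    isFiniteMeasure_withDensity_ofReal (integrable_gaussianShift w).2
  have : IsProbabilityMeasure ((stdGaussian (Param p)).map (fun x => w + x)) :=
    Measure.isProbabilityMeasure_map (by fun_prop)
  refine Measure.ext_of_charFun ?_
  ext t
  rw [charFun_apply, charFun_apply, integral_map (by fun_prop) (by fun_prop)]
  rw [integral_withDensity_eq_integral_toReal_smul
    (continuous_gaussianShift w).measurable.ennreal_ofReal (by simp)]
  have e1 : ∀ x : Param p, Complex.exp (inner ℝ (w + x) t * Complex.I) =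
      Complex.exp (inner ℝ w t * Complex.I) *
        Complex.exp (∑ i, (t i * Complex.I) * (x i : ℂ)) := fun x => by
    rw [← Complex.exp_add, inner_add_left]
    congr 1
    simp [PiLp.inner_apply, add_mul, Finset.sum_mul]
    refine Finset.sum_congr rfl fun i _ => by ring
  have e2 : ∀ x : Param p, (ENNReal.ofReal (gaussianShift w x)).toReal •
      Complex.exp (inner ℝ x t * Complex.I) =
      Complex.exp (-(‖w‖ ^ 2 / 2 : ℝ)) *
        Complex.exp (∑ i, (w i + t i * Complex.I) * (x i : ℂ)) := fun x => by
    rw [ENNReal.toReal_ofReal (gaussianShift_pos w x).le, Complex.real_smul, gaussianShift,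
      Complex.ofReal_exp, ← Complex.exp_add, ← Complex.exp_add]
    congr 1
    simp [PiLp.inner_apply, add_mul, Finset.sum_mul, Finset.sum_add_distrib]
    have : ∑ i, (x i : ℂ) * w i = ∑ i, (w i : ℂ) * x i :=
      Finset.sum_congr rfl fun i _ => by ring
    have : ∑ i, (t i : ℂ) * x i * Complex.I = ∑ i, (t i : ℂ) * Complex.I * x i :=
      Finset.sum_congr rfl fun i _ => by ring
    simp only [*]
    ring
  simp_rw [e1, e2]
  rw [integral_const_mul, integral_const_mul, integral_cexp_sum_stdGaussian,
    integral_cexp_sum_stdGaussian, ← Complex.exp_add, ← Complex.exp_add]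
  congr 1
  rw [EuclideanSpace.real_norm_sq_eq, PiLp.inner_apply]
  push_cast
  rw [Finset.sum_div, Finset.sum_mul, ← Finset.sum_add_distrib, ← Finset.sum_neg_distrib,
    ← Finset.sum_add_distrib]
  refine Finset.sum_congr rfl fun i _ => ?_
  simp
  ring

lemma noise_eq_map_stdGaussian {σsq : ℝ} (hσ : 0 ≤ σsq) :
    noise p σsq = (stdGaussian (Param p)).map fun x => Real.sqrt σsq • x := by
  have hS : (σsq • (1 : Matrix (Fin p) (Fin p) ℝ)).PosSemidef :=
    Matrix.PosSemidef.one.smul hσ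
  have : IsProbabilityMeasure ((stdGaussian (Param p)).map fun x => Real.sqrt σsq • x) :=
    Measure.isProbabilityMeasure_map (by fun_prop)
  refine Measure.ext_of_charFun ?_
  ext t
  rw [noise, charFun_multivariateGaussian hS, charFun_map_smul, charFun_stdGaussian]
  congr 1
  rw [norm_smul, Real.norm_of_nonneg (Real.sqrt_nonneg _)]
  push_cast
  rw [mul_pow, ← Complex.ofReal_pow, Real.sq_sqrt hσ, ← Complex.ofReal_pow,
    EuclideanSpace.real_norm_sq_eq]
  simp [Matrix.smul_mulVec, dotProduct, Finset.mul_sum, Finset.sum_div, pow_two, neg_div]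
  exact Finset.sum_congr rfl fun i _ => by ring

instance (σsq : ℝ) : IsGaussian (noise p σsq) := by
  unfold noise; infer_instance

lemma integrable_noise (σsq : ℝ) : Integrable (fun x : Param p => x) (noise p σsq) :=
  IsGaussian.integrable_fun_id

lemma integral_noise (σsq : ℝ) : ∫ x, x ∂(noise p σsq) = 0 := by
  rw [noise, integral_id_multivariateGaussian]

lemma integrable_norm_sq_noise (σsq : ℝ) :
    Integrable (fun x : Param p => ‖x‖ ^ 2) (noise p σsq) := by
  have : MemLp (fun x : Param p => x) 2 (noise p σsq) := IsGaussian.memLp_two_id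
  exact this.integrable_norm_pow (by norm_num)

lemma integral_norm_sq_noise {σsq : ℝ} (hσ : 0 ≤ σsq) :
    ∫ x, ‖x‖ ^ 2 ∂(noise p σsq) = p * σsq := by
  have hS : (σsq • (1 : Matrix (Fin p) (Fin p) ℝ)).PosSemidef :=
    Matrix.PosSemidef.one.smul hσ
  have hL : MemLp (fun x : Param p => x) 2 (noise p σsq) := IsGaussian.memLp_two_id
  have hLi : ∀ i, MemLp (fun x : Param p => x i) 2 (noise p σsq) := fun i =>
    hL.continuousLinearMap_comp (EuclideanSpace.proj (𝕜 := ℝ) i)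
  simp_rw [EuclideanSpace.real_norm_sq_eq]
  rw [integral_finsetSum _ fun i _ => (hLi i).integrable_sq]
  have : ∀ i : Fin p, ∫ x : Param p, x i ^ 2 ∂(noise p σsq) = σsq := fun i => by
    have hv := variance_eval_multivariateGaussian (μ := (0 : Param p)) hS i
    have h0 : ∫ x : Param p, x i ∂(noise p σsq) = 0 := by
      have := (EuclideanSpace.proj (𝕜 := ℝ) i).integral_comp_comm (integrable_noise (p := p) σsq)
      rw [integral_noise] at this
      simpa using this
    rw [← noise] at hv
    rw [variance_of_integral_eq_zero (hLi i).aestronglyMeasurable.aemeasurable h0] at hv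
    simpa using hv
  simp [this]

end Gaussian

/-! ### A dual form of bounds on the Rényi divergence -/

section HolderDominated

variable {Ω Ω' : Type*} [MeasurableSpace Ω] [MeasurableSpace Ω']

/-- `∫ f dμ ≤ A (∫ f ^ b dν) ^ (1 / b)` for all `f ≥ 0`. By duality this bounds the moment
of order `a` of `dμ/dν` under `ν` by `A ^ a`, where `1 / a + 1 / b = 1`; in this form the
behavior under maps and under composition of kernels is immediate. -/
def HolderDominated (b : ℝ) (A : ℝ≥0∞) (μ ν : Measure Ω) : Prop :=
  ∀ f : Ω → ℝ≥0∞, Measurable f → ∫⁻ x, f x ∂μ ≤ A * (∫⁻ x, f x ^ b ∂ν) ^ (1 / b)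

lemma HolderDominated.mono {b : ℝ} {A B : ℝ≥0∞} {μ ν : Measure Ω}
    (h : HolderDominated b A μ ν) (hAB : A ≤ B) : HolderDominated b B μ ν :=
  fun f hf => (h f hf).trans (mul_le_mul_left hAB _)

lemma HolderDominated.dirac {b : ℝ} (hb : 0 < b) (x : Ω) :
    HolderDominated b 1 (Measure.dirac x) (Measure.dirac x) := fun f hf => by
  rw [lintegral_dirac' _ hf, lintegral_dirac' _ (hf.pow_const b), ← ENNReal.rpow_mul,
    mul_one_div_cancel hb.ne', ENNReal.rpow_one, one_mul]

lemma HolderDominated.map {b : ℝ} {A : ℝ≥0∞} {μ ν : Measure Ω} (h : HolderDominated b A μ ν)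
    {g : Ω → Ω'} (hg : Measurable g) : HolderDominated b A (μ.map g) (ν.map g) := fun f hf => by
  rw [lintegral_map hf hg, lintegral_map (hf.pow_const b) hg]
  exact h _ (hf.comp hg)

/-- The bound for the kernels produces the function `x ↦ (∫ f ^ b dκ' x) ^ (1 / b)`, to which the
bound for `μ, ν` applies; its `b`-th power is the inner integral, so the constants simply multiply.
-/
lemma HolderDominated.bind {b : ℝ} (hb : 0 < b) {A B : ℝ≥0∞} {μ ν : Measure Ω}
    (h : HolderDominated b A μ ν) {κ κ' : Ω → Measure Ω'} (hκ : Measurable κ)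
    (hκ' : Measurable κ') (hB : ∀ x, HolderDominated b B (κ x) (κ' x)) :
    HolderDominated b (A * B) (μ.bind κ) (ν.bind κ') := fun f hf => by
  have hm : Measurable fun x => ∫⁻ y, f y ^ b ∂(κ' x) :=
    (Measure.measurable_lintegral (hf.pow_const b)).comp hκ'
  rw [Measure.lintegral_bind hκ.aemeasurable hf.aemeasurable,
    Measure.lintegral_bind hκ'.aemeasurable (hf.pow_const b).aemeasurable]
  calc ∫⁻ x, ∫⁻ y, f y ∂(κ x) ∂μ
      ≤ ∫⁻ x, B * (∫⁻ y, f y ^ b ∂(κ' x)) ^ (1 / b) ∂μ := lintegral_mono fun x => hB x f hf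
    _ = B * ∫⁻ x, (∫⁻ y, f y ^ b ∂(κ' x)) ^ (1 / b) ∂μ :=
        lintegral_const_mul _ (hm.pow_const _)
    _ ≤ B * (A * (∫⁻ x, ((∫⁻ y, f y ^ b ∂(κ' x)) ^ (1 / b)) ^ b ∂ν) ^ (1 / b)) :=
        mul_le_mul_right (h _ (hm.pow_const _)) _
    _ = A * B * (∫⁻ x, ∫⁻ y, f y ^ b ∂(κ' x) ∂ν) ^ (1 / b) := by
        simp_rw [← ENNReal.rpow_mul, one_div_mul_cancel hb.ne', ENNReal.rpow_one]
        ring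

/-- Hölder's inequality for the factorization `f h = (f g ^ (-1 / b)) (h g ^ (1 / b))`; since `a / b
= a - 1`, the first factor has `a`-th power `f ^ a g ^ (1 - a)`. -/
lemma HolderDominated.withDensity {a b : ℝ} (hab : a.HolderConjugate b) {γ : Measure Ω}
    {f g : Ω → ℝ} (hf : Measurable f) (hg : Measurable g) (hf0 : ∀ x, 0 < f x)
    (hg0 : ∀ x, 0 < g x) {M : ℝ≥0∞}
    (hM : ∫⁻ x, ENNReal.ofReal (f x ^ a * g x ^ (1 - a)) ∂γ ≤ M) :
    HolderDominated b (M ^ (1 / a)) (γ.withDensity fun x => ENNReal.ofReal (f x))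
      (γ.withDensity fun x => ENNReal.ofReal (g x)) := fun h hh => by
  have ha := hab.pos
  have hb := hab.symm.pos
  rw [lintegral_withDensity_eq_lintegral_mul _ hf.ennreal_ofReal hh,
    lintegral_withDensity_eq_lintegral_mul _ hg.ennreal_ofReal (hh.pow_const b)]
  have e1 : ∀ x, ENNReal.ofReal (f x) * h x =
      ENNReal.ofReal (f x * g x ^ (-(1 / b))) * (h x * ENNReal.ofReal (g x ^ (1 / b))) := by
    intro x
    have : f x = f x * g x ^ (-(1 / b)) * g x ^ (1 / b) := by
      rw [mul_assoc, ← Real.rpow_add (hg0 x)]; simp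
    conv_lhs => rw [this, ENNReal.ofReal_mul (mul_nonneg (hf0 x).le
      (Real.rpow_nonneg (hg0 x).le _))]
    ring
  have e2 : ∀ x, (h x * ENNReal.ofReal (g x ^ (1 / b))) ^ b = ENNReal.ofReal (g x) * h x ^ b := by
    intro x
    rw [ENNReal.mul_rpow_of_nonneg _ _ hb.le, ENNReal.ofReal_rpow_of_pos
      (Real.rpow_pos_of_pos (hg0 x) _), ← Real.rpow_mul (hg0 x).le, one_div_mul_cancel hb.ne',
      Real.rpow_one, mul_comm]
  have e3 : ∀ x, ENNReal.ofReal (f x * g x ^ (-(1 / b))) ^ a =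
      ENNReal.ofReal (f x ^ a * g x ^ (1 - a)) := by
    intro x
    rw [ENNReal.ofReal_rpow_of_pos (mul_pos (hf0 x) (Real.rpow_pos_of_pos (hg0 x) _)),
      Real.mul_rpow (hf0 x).le (Real.rpow_nonneg (hg0 x).le _), ← Real.rpow_mul (hg0 x).le]
    congr 3
    have : a⁻¹ + b⁻¹ = 1 := hab.inv_add_inv_eq_one
    field_simp at this ⊢
    linarith
  calc ∫⁻ x, ((fun x => ENNReal.ofReal (f x)) * h) x ∂γ
      = ∫⁻ x, ((fun x => ENNReal.ofReal (f x * g x ^ (-(1 / b)))) *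
          (fun x => h x * ENNReal.ofReal (g x ^ (1 / b)))) x ∂γ := lintegral_congr e1
    _ ≤ (∫⁻ x, ENNReal.ofReal (f x * g x ^ (-(1 / b))) ^ a ∂γ) ^ (1 / a) *
          (∫⁻ x, (h x * ENNReal.ofReal (g x ^ (1 / b))) ^ b ∂γ) ^ (1 / b) :=
        ENNReal.lintegral_mul_le_Lp_mul_Lq γ hab
          (hf.mul (hg.pow_const _)).ennreal_ofReal.aemeasurable
          (hh.mul (hg.pow_const _).ennreal_ofReal).aemeasurable
    _ ≤ _ := by
        simp_rw [e2, e3]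
        exact mul_le_mul_left (ENNReal.rpow_le_rpow hM (by positivity)) _

/-- Weighted AM–GM with the two factors rescaled by powers of `c = b * exp ε` that cancel in the
product. The choice of `c` makes the second term exactly `exp ε * t`, and the first has the
coefficient `(4 / a) b ^ (-(a - 1)) ≤ 4 * (1 / 2) * (1 / 2) = 1`, which is why a moment of size `4`
is affordable. -/
lemma four_rpow_mul_rpow_le {a b ε x t : ℝ} (hab : a.HolderConjugate b) (ha : 2 ≤ a)
    (hx : x ≤ (a - 1) * ε) (ht : 0 ≤ t) :
    (4 : ℝ) ^ (1 / a) * t ^ (1 / b) ≤ Real.exp ε * t + Real.exp (-x) := by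
  have hb := hab.symm.pos
  have hba : b = 1 + 1 / (a - 1) := by
    rw [hab.conjugate_eq]; field_simp [show a - 1 ≠ 0 by linarith]; ring
  have hinv : 1 / a + 1 / b = 1 := by simpa using hab.inv_add_inv_eq_one
  have hc : 0 < b * Real.exp ε := by positivity
  -- Bernoulli's inequality for `b = 1 + 1 / (a - 1)`.
  have h2 : (2 : ℝ) ≤ b ^ (a - 1) := by
    have := one_add_mul_self_le_rpow_one_add (s := 1 / (a - 1)) (p := a - 1)
      (le_trans (by norm_num) (one_div_nonneg.2 (by linarith))) (by linarith)
    rw [mul_one_div_cancel (by linarith), ← hba] at this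
    linarith
  have key := Real.geom_mean_le_arith_mean2_weighted (w₁ := 1 / a) (w₂ := 1 / b)
    (p₁ := 4 * (b * Real.exp ε) ^ (-(a - 1))) (p₂ := b * Real.exp ε * t)
    (by positivity) (by positivity) (by positivity) (by positivity) hinv
  have e1 : (4 * (b * Real.exp ε) ^ (-(a - 1))) ^ (1 / a) * (b * Real.exp ε * t) ^ (1 / b) =
      (4 : ℝ) ^ (1 / a) * t ^ (1 / b) := by
    rw [Real.mul_rpow (by norm_num) (by positivity), Real.mul_rpow hc.le ht, ← Real.rpow_mul hc.le]
    have : (b * Real.exp ε) ^ (-(a - 1) * (1 / a)) * (b * Real.exp ε) ^ (1 / b) = 1 := by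
      rw [← Real.rpow_add hc]
      have : -(a - 1) * (1 / a) + 1 / b = 0 := by
        have : a * (1 / a) = 1 := mul_one_div_cancel (by linarith)
        linarith
      rw [this, Real.rpow_zero]
    linear_combination (4 : ℝ) ^ (1 / a) * t ^ (1 / b) * this
  have e2 : 1 / a * (4 * (b * Real.exp ε) ^ (-(a - 1))) ≤ Real.exp (-x) := by
    rw [Real.mul_rpow hb.le (Real.exp_pos _).le, ← Real.exp_mul, Real.rpow_neg hb.le]
    have h3 : Real.exp (ε * -(a - 1)) ≤ Real.exp (-x) := Real.exp_le_exp.2 (by linarith)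
    have h4 : (b ^ (a - 1))⁻¹ ≤ 1 / 2 := by
      rw [inv_eq_one_div]; exact one_div_le_one_div_of_le (by norm_num) h2
    have h5 : 1 / a ≤ 1 / 2 := one_div_le_one_div_of_le (by norm_num) ha
    have h6 : 0 ≤ 1 / a := by positivity
    have h7 : 0 ≤ (b ^ (a - 1))⁻¹ := by positivity
    have h8 : 1 / a * (b ^ (a - 1))⁻¹ ≤ 1 / 2 * (1 / 2) := mul_le_mul h5 h4 h7 (by norm_num)
    have h9 := Real.exp_pos (ε * -(a - 1))
    nlinarith
  have e3 : 1 / b * (b * Real.exp ε * t) = Real.exp ε * t := by field_simp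
  linarith

/-- Testing the dual inequality on the indicator of `S` gives `μ S ≤ 4 ^ (1 / a) * (ν S) ^ (1 / b)`;
the rest is the scalar inequality above. -/
lemma HolderDominated.measure_le {a b ε x : ℝ} (hab : a.HolderConjugate b) (ha : 2 ≤ a)
    (hx : x ≤ (a - 1) * ε) {μ ν : Measure Ω} [IsFiniteMeasure ν]
    (h : HolderDominated b (ENNReal.ofReal 4 ^ (1 / a)) μ ν) {S : Set Ω} (hS : MeasurableSet S) :
    μ S ≤ ENNReal.ofReal (Real.exp ε) * ν S + ENNReal.ofReal (Real.exp (-x)) := by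
  have hb := hab.symm.pos
  have h1 := h (S.indicator 1) (measurable_one.indicator hS)
  have e : ∀ y, S.indicator (1 : Ω → ℝ≥0∞) y ^ b = S.indicator 1 y := fun y => by
    by_cases hy : y ∈ S <;> simp [hy, hb]
  simp_rw [e] at h1
  rw [lintegral_indicator_one hS, lintegral_indicator_one hS,
    ← ENNReal.ofReal_toReal (measure_ne_top ν S), ENNReal.ofReal_rpow_of_pos (by norm_num),
    ENNReal.ofReal_rpow_of_nonneg ENNReal.toReal_nonneg (by positivity),
    ← ENNReal.ofReal_mul (by positivity)] at h1
  refine h1.trans ?_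
  rw [← ENNReal.ofReal_toReal (measure_ne_top ν S), ← ENNReal.ofReal_mul (by positivity),
    ← ENNReal.ofReal_add (by positivity) (by positivity)]
  refine ENNReal.ofReal_le_ofReal ?_
  simpa using four_rpow_mul_rpow_le hab ha hx (t := (ν S).toReal) ENNReal.toReal_nonneg

end HolderDominated

/-! ### Moments of the likelihood ratio of neighboring Gaussian mixtures -/

/-! ### Second differences of Gaussian moments, and a Taylor bound for powers. -/

section Scalar

/-- The value of `∫ f₁ ^ α f₂ ^ (2 - α) / f₃` for Gaussian densities `f₁, f₂, f₃` of means
`w₁, w₂, w₃`, where `A = ⟪w₂ - w₃, w₁ - w₂⟫`, `B = ‖w₂ - w₃‖²` and `d = ‖w₁ - w₂‖²`. -/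
def gaussianMoment (A B d α : ℝ) : ℝ := Real.exp (B + α * A + α * (α - 1) * d / 2)

/-- The exponent is quadratic in `α`, so the outer two moments are the middle one times `exp (d / 2)
* exp (± D)`. The second difference is therefore `2 (exp (d / 2) cosh D - 1)` times the middle
moment, and `cosh D ≤ exp (D ^ 2 / 2)`. -/
lemma gaussianMoment_second_diff_le (A B d m : ℝ) :
    gaussianMoment A B d (m + 2) - 2 * gaussianMoment A B d (m + 1) + gaussianMoment A B d m ≤
      2 * gaussianMoment A B d (m + 1) *
        (Real.exp ((d + (A + (m + 1 / 2) * d) ^ 2) / 2) - 1) := by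
  set D := A + (m + 1 / 2) * d with hD
  have h1 : gaussianMoment A B d (m + 2) =
      gaussianMoment A B d (m + 1) * (Real.exp (d / 2) * Real.exp D) := by
    rw [gaussianMoment, gaussianMoment, ← Real.exp_add, ← Real.exp_add]
    congr 1; rw [hD]; ring
  have h2 : gaussianMoment A B d m =
      gaussianMoment A B d (m + 1) * (Real.exp (d / 2) * Real.exp (-D)) := by
    rw [gaussianMoment, gaussianMoment, ← Real.exp_add, ← Real.exp_add]
    congr 1; rw [hD]; ring
  have h3 := Real.cosh_le_exp_half_sq D
  rw [Real.cosh_eq] at h3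
  have h4 : Real.exp ((d + D ^ 2) / 2) = Real.exp (d / 2) * Real.exp (D ^ 2 / 2) := by
    rw [← Real.exp_add]; congr 1; ring
  have h5 : 0 < gaussianMoment A B d (m + 1) := Real.exp_pos _
  have h6 := Real.exp_pos (d / 2)
  rw [h1, h2, h4]
  have h7 := mul_le_mul_of_nonneg_left h3 (mul_pos h5 h6).le
  linarith

/-- Under the smallness conditions the middle moment is at most `exp (5 / 16) ≤ 1.4` and the
exponential factor minus one at most `5 / 7 * t`; the constants are matched so that `2 * 1.4 * 5 / 7
= 2`. -/
lemma gaussianMoment_second_diff_le_of_small {A B d m t : ℝ} (hm : 0 ≤ m) (hd0 : 0 ≤ d)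
    (hd : d ≤ t) (hB : B ≤ t) (hA : |A| ≤ t) (ht : t ≤ 1 / 8) (hmt : (m + 1) ^ 2 * t ≤ 1 / 8) :
    gaussianMoment A B d (m + 2) - 2 * gaussianMoment A B d (m + 1) + gaussianMoment A B d m ≤
      2 * t := by
  refine (gaussianMoment_second_diff_le A B d m).trans ?_
  obtain ⟨hA1, hA2⟩ := abs_le.1 hA
  have ht0 : 0 ≤ t := hd0.trans hd
  have hl : (m + 1) * t ≤ 1 / 8 := by nlinarith [mul_nonneg hm ht0]
  have hG : gaussianMoment A B d (m + 1) ≤ 1.4 := by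
    have h1 : B + (m + 1) * A + (m + 1) * (m + 1 - 1) * d / 2 ≤ 5 / 16 := by
      have h2 : (m + 1) * A ≤ (m + 1) * t := mul_le_mul_of_nonneg_left hA2 (by linarith)
      have h3 : (m + 1) * (m + 1 - 1) * d ≤ (m + 1) ^ 2 * t := by
        have : (m + 1) * (m + 1 - 1) * d ≤ (m + 1) ^ 2 * d := by
          apply mul_le_mul_of_nonneg_right _ hd0; nlinarith
        exact this.trans (mul_le_mul_of_nonneg_left hd (by positivity))
      linarith
    refine (Real.exp_le_exp.2 h1).trans ?_
    have h4 := Real.exp_bound' (x := 5 / 16) (by norm_num) (by norm_num) (n := 4) (by norm_num)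
    refine h4.trans ?_
    norm_num [Finset.sum_range_succ, Nat.factorial]
  have hG0 : 0 < gaussianMoment A B d (m + 1) := Real.exp_pos _
  set D := A + (m + 1 / 2) * d with hD
  have hDa : |D| ≤ 3 / 2 * ((m + 1) * t) := by
    have h1 : 0 ≤ (m + 1 / 2) * d := by positivity
    have h2 : (m + 1 / 2) * d ≤ (m + 1 / 2) * t := mul_le_mul_of_nonneg_left hd (by linarith)
    have h3 : 0 ≤ m * t := mul_nonneg hm ht0
    rw [abs_le]; constructor <;> linarith
  have hD2 : D ^ 2 ≤ 9 / 32 * t := by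
    have h1 : D ^ 2 ≤ (3 / 2 * ((m + 1) * t)) ^ 2 := sq_le_sq' (by linarith [abs_le.1 hDa])
      (abs_le.1 hDa).2
    nlinarith
  have hu : (d + D ^ 2) / 2 ≤ 41 / 64 * t := by linarith
  have hu1 : 41 / 64 * t ≤ 41 / 512 := by linarith
  have he : Real.exp ((d + D ^ 2) / 2) - 1 ≤ 5 / 7 * t := by
    have h1 : Real.exp (41 / 64 * t) ≤ 1 / (1 - 41 / 64 * t) :=
      Real.exp_bound_div_one_sub_of_interval (by positivity) (by linarith)
    have h2 : 1 / (1 - 41 / 64 * t) ≤ 1 + 5 / 7 * t := by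
      rw [div_le_iff₀ (by linarith)]; nlinarith
    have h3 := Real.exp_le_exp.2 hu
    linarith
  have he0 : 0 ≤ 5 / 7 * t := by positivity
  nlinarith

/-- For order two, `t` need not be so small. The outer moments are squares `u ^ 2`, `w ^ 2` with `u,
w ∈ [1, Q]`, and the middle one is at least `u * w / Q`; the resulting bound is largest at `u = w =
Q`. Controlling `B + 2 * A + d`, itself a squared distance in the application, avoids the loss of
bounding `A` by Cauchy–Schwarz. -/
lemma gaussianMoment_second_diff_zero_le {A B d t : ℝ} (hB0 : 0 ≤ B) (hd : d ≤ t)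
    (hB : B ≤ t) (hABd0 : 0 ≤ B + 2 * A + d) (hABd : B + 2 * A + d ≤ t) :
    gaussianMoment A B d 2 - 2 * gaussianMoment A B d 1 + gaussianMoment A B d 0 ≤
      2 * Real.exp (t / 2) * (Real.exp (t / 2) - 1) := by
  set u := Real.exp ((B + 2 * A + d) / 2) with hu
  set w := Real.exp (B / 2) with hw
  set Q := Real.exp (t / 2) with hQ
  have hQ0 : 0 < Q := Real.exp_pos _
  have h2 : gaussianMoment A B d 2 = u ^ 2 := by
    rw [gaussianMoment, hu, ← Real.exp_nat_mul]; congr 1; push_cast; ring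
  have h0 : gaussianMoment A B d 0 = w ^ 2 := by
    rw [gaussianMoment, hw, ← Real.exp_nat_mul]; congr 1; push_cast; ring
  have h1 : u * w ≤ Q * gaussianMoment A B d 1 := by
    rw [gaussianMoment, hu, hw, hQ, ← Real.exp_add, ← Real.exp_add]
    apply Real.exp_le_exp.2; linarith
  have hu1 : 1 ≤ u := Real.one_le_exp (by linarith)
  have hw1 : 1 ≤ w := Real.one_le_exp (by linarith)
  have huQ : u ≤ Q := Real.exp_le_exp.2 (by linarith)
  have hwQ : w ≤ Q := Real.exp_le_exp.2 (by linarith)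
  rw [h2, h0]
  have h3 : Q * (u ^ 2 - 2 * gaussianMoment A B d 1 + w ^ 2) ≤ Q * (2 * Q * (Q - 1)) := by
    have e : 0 ≤ (Q - u) * (u - 1) := mul_nonneg (by linarith) (by linarith)
    have h4 : Q * (u ^ 2 + w ^ 2) - 2 * (u * w) ≤ Q * (2 * Q * (Q - 1)) := by
      have a1 : 0 ≤ (Q - u) * (Q * (Q + u) - 2 * w) := by
        apply mul_nonneg (by linarith)
        nlinarith
      have a2 : 0 ≤ (Q - w) * (Q * (Q + w) - 2 * Q) := by
        apply mul_nonneg (by linarith)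
        nlinarith
      nlinarith
    nlinarith
  exact le_of_mul_le_mul_left h3 hQ0

/-- A second-order Taylor bound for `r ^ a`. -/
lemma rpow_le_quadratic {a r : ℝ} (ha : 2 ≤ a) (hr : 0 < r) :
    r ^ a ≤ 1 + a * (r - 1) + a * (a - 1) * (r - 1) ^ 2 * max 1 (r ^ (a - 2)) := by
  -- The tangent line of `s ↦ s ^ c` at `r`, evaluated at `1`; it is Bernoulli's inequality at
  -- `r⁻¹`.
  have tangent : ∀ c : ℝ, 1 ≤ c → r ^ c - 1 ≤ c * r ^ (c - 1) * (r - 1) := fun c hc => by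
    have h := one_add_mul_self_le_rpow_one_add (s := r⁻¹ - 1) (p := c)
      (by linarith [inv_pos.2 hr]) hc
    rw [add_sub_cancel, Real.inv_rpow hr.le] at h
    have hc0 : 0 < r ^ c := Real.rpow_pos_of_pos hr c
    have h2 := mul_le_mul_of_nonneg_left h hc0.le
    rw [mul_inv_cancel₀ hc0.ne'] at h2
    have h3 : r ^ (c - 1) * r = r ^ c := by
      rw [← Real.rpow_add_one hr.ne']; congr 1; ring
    have h4 : r ^ c * r⁻¹ = r ^ (c - 1) := by
      rw [← h3]; field_simp
    nlinarith
  have h1 := tangent a (by linarith)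
  -- This is what exceeds the linear term in the tangent bound for `r ^ a`. The tangent bound for
  -- the exponent `a - 1` handles `r ≥ 1`, Bernoulli handles `r ≤ 1`.
  have h2 : (r - 1) * (r ^ (a - 1) - 1) ≤ (a - 1) * (r - 1) ^ 2 * max 1 (r ^ (a - 2)) := by
    rcases le_total 1 r with h | h
    · have h3 := tangent (a - 1) (by linarith)
      rw [show a - 1 - 1 = a - 2 by ring] at h3
      have h4 : (a - 1) * r ^ (a - 2) * (r - 1) ≤ (a - 1) * (max 1 (r ^ (a - 2))) * (r - 1) :=
        mul_le_mul_of_nonneg_right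
          (mul_le_mul_of_nonneg_left (le_max_right _ _) (by linarith)) (by linarith)
      have h5 := mul_le_mul_of_nonneg_left (h3.trans h4) (sub_nonneg.2 h)
      linarith
    · have h3 := one_add_mul_self_le_rpow_one_add (s := r - 1) (p := a - 1)
        (by linarith) (by linarith)
      rw [add_sub_cancel] at h3
      have h5 : (1 - r) * (1 - r ^ (a - 1)) ≤ (1 - r) * ((a - 1) * (1 - r)) :=
        mul_le_mul_of_nonneg_left (by linarith) (by linarith)
      have h6 : (a - 1) * (r - 1) ^ 2 * 1 ≤ (a - 1) * (r - 1) ^ 2 * max 1 (r ^ (a - 2)) :=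
        mul_le_mul_of_nonneg_left (le_max_left _ _) (mul_nonneg (by linarith) (sq_nonneg _))
      linarith
  have h3 := mul_le_mul_of_nonneg_left h2 (show 0 ≤ a by linarith)
  linarith

end Scalar

/-! ### Likelihood ratios of Gaussian mixtures that differ in one center. -/

section Mixture

variable {p n : ℕ}

lemma gaussianShift_rpow_mul_div (w₁ w₂ w₃ x : Param p) (α : ℝ) :
    gaussianShift w₁ x ^ α * gaussianShift w₂ x ^ (2 - α) / gaussianShift w₃ x =
      Real.exp (inner ℝ (α • w₁ + (2 - α) • w₂ - w₃) x) *
        Real.exp (-(α * ‖w₁‖ ^ 2 + (2 - α) * ‖w₂‖ ^ 2 - ‖w₃‖ ^ 2) / 2) := by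
  rw [gaussianShift, gaussianShift, gaussianShift, ← Real.exp_mul, ← Real.exp_mul, ← Real.exp_add,
    ← Real.exp_sub, ← Real.exp_add]
  congr 1
  rw [inner_sub_left, inner_add_left, real_inner_smul_left, real_inner_smul_left]
  ring

lemma integrable_gaussianShift_rpow_mul_div (w₁ w₂ w₃ : Param p) (α : ℝ) :
    Integrable (fun x => gaussianShift w₁ x ^ α * gaussianShift w₂ x ^ (2 - α) /
      gaussianShift w₃ x) (stdGaussian (Param p)) := by
  simp_rw [gaussianShift_rpow_mul_div]
  exact (integrable_exp_inner_stdGaussian _).mul_const _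

lemma integral_gaussianShift_rpow_mul_div (w₁ w₂ w₃ : Param p) (α : ℝ) :
    ∫ x, gaussianShift w₁ x ^ α * gaussianShift w₂ x ^ (2 - α) / gaussianShift w₃ x
      ∂(stdGaussian (Param p)) =
      gaussianMoment (inner ℝ (w₂ - w₃) (w₁ - w₂)) (‖w₂ - w₃‖ ^ 2) (‖w₁ - w₂‖ ^ 2) α := by
  simp_rw [gaussianShift_rpow_mul_div]
  rw [integral_mul_const, integral_exp_inner_stdGaussian, ← Real.exp_add, gaussianMoment]
  congr 1
  simp only [← real_inner_self_eq_norm_sq, inner_sub_left, inner_sub_right, inner_add_left,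
    inner_add_right, real_inner_smul_left, real_inner_smul_right]
  rw [real_inner_comm w₁ w₂, real_inner_comm w₁ w₃, real_inner_comm w₂ w₃]
  ring

/-- Expanding the square leaves terms of the form integrated in closed form above, with `α = m + 2,
m + 1, m`; this is where the second difference of `gaussianMoment` comes from. -/
lemma sq_sub_mul_div_rpow_div_eq {f₁ f₂ f₃ : ℝ} (h₁ : 0 < f₁) (h₂ : 0 < f₂) (m : ℝ) :
    (f₁ - f₂) ^ 2 * (f₁ / f₂) ^ m / f₃ =
      f₁ ^ (m + 2) * f₂ ^ (2 - (m + 2)) / f₃ - 2 * (f₁ ^ (m + 1) * f₂ ^ (2 - (m + 1)) / f₃) +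
        f₁ ^ m * f₂ ^ (2 - m) / f₃ := by
  have e1 : f₁ ^ (m + 2) = f₁ ^ m * f₁ ^ 2 := by
    rw [Real.rpow_add h₁]; norm_cast
  have e2 : f₁ ^ (m + 1) = f₁ ^ m * f₁ := by rw [Real.rpow_add_one h₁.ne']
  have e3 : f₂ ^ (2 - (m + 2)) = (f₂ ^ m)⁻¹ := by
    rw [← Real.rpow_neg h₂.le]; congr 1; ring
  have e4 : f₂ ^ (2 - (m + 1)) = (f₂ ^ m)⁻¹ * f₂ := by
    rw [← Real.rpow_neg h₂.le, ← Real.rpow_add_one h₂.ne']; congr 1; ring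
  have e5 : f₂ ^ (2 - m) = (f₂ ^ m)⁻¹ * f₂ ^ 2 := by
    rw [← Real.rpow_neg h₂.le, sub_eq_neg_add, Real.rpow_add h₂]; norm_cast
  rw [e1, e2, e3, e4, e5, Real.div_rpow h₁.le h₂.le]
  ring

/-- The density of the uniform mixture of the Gaussians `N(v j, 1)`. -/
def mixture (v : Fin n → Param p) (x : Param p) : ℝ := (∑ j, gaussianShift (v j) x) / n

lemma continuous_mixture (v : Fin n → Param p) : Continuous (mixture v) := by
  have := fun j => continuous_gaussianShift (v j)
  unfold mixture; fun_prop

lemma mixture_pos [NeZero n] (v : Fin n → Param p) (x : Param p) : 0 < mixture v x := by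
  have hn : (0 : ℝ) < n := by exact_mod_cast Nat.pos_of_ne_zero (NeZero.ne n)
  exact div_pos (Finset.sum_pos (fun j _ => gaussianShift_pos _ _) Finset.univ_nonempty) hn

lemma integrable_mixture (v : Fin n → Param p) :
    Integrable (mixture v) (stdGaussian (Param p)) :=
  (integrable_finsetSum _ fun j _ => integrable_gaussianShift (v j)).div_const _

lemma integral_mixture [NeZero n] (v : Fin n → Param p) :
    ∫ x, mixture v x ∂(stdGaussian (Param p)) = 1 := by
  have hn : (n : ℝ) ≠ 0 := by exact_mod_cast NeZero.ne n
  unfold mixture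
  rw [integral_div, integral_finsetSum _ fun j _ => integrable_gaussianShift (v j)]
  simp [integral_gaussianShift, hn]

lemma lintegral_uniformOn_univ (f : Fin n → ℝ≥0∞) :
    ∫⁻ i, f i ∂(uniformOn (Set.univ : Set (Fin n))) = ∑ i, f i / n := by
  rw [lintegral_fintype]
  refine Finset.sum_congr rfl fun i _ => ?_
  rw [uniformOn_univ, Measure.count_singleton]
  simp [div_eq_mul_inv]

lemma map_add_eq_withDensity_mixture [NeZero n] (v : Fin n → Param p) :
    ((uniformOn (Set.univ : Set (Fin n))).prod (stdGaussian (Param p))).map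
      (fun ib => v ib.1 + ib.2) =
    (stdGaussian (Param p)).withDensity fun x => ENNReal.ofReal (mixture v x) := by
  have hn : (0 : ℝ) < n := by exact_mod_cast Nat.pos_of_ne_zero (NeZero.ne n)
  have hm : Measurable fun ib : Fin n × Param p => v ib.1 + ib.2 :=
    measurable_from_prod_countable_right fun i => measurable_const_add (v i)
  ext S hS
  rw [Measure.map_apply hm hS, Measure.prod_apply (hm hS), lintegral_uniformOn_univ,
    withDensity_apply _ hS]
  have e : ∀ x : Param p, ENNReal.ofReal (mixture v x) =
      ∑ j, ENNReal.ofReal (gaussianShift (v j) x) / n := fun x => by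
    rw [mixture, ENNReal.ofReal_div_of_pos hn,
      ENNReal.ofReal_sum_of_nonneg fun j _ => (gaussianShift_pos _ _).le, ENNReal.ofReal_natCast]
    simp_rw [div_eq_mul_inv, Finset.sum_mul]
  simp_rw [e]
  have hmj : ∀ j, Measurable fun x => ENNReal.ofReal (gaussianShift (v j) x) := fun j =>
    (continuous_gaussianShift (v j)).measurable.ennreal_ofReal
  rw [lintegral_finsetSum _ fun j _ => (hmj j).div_const _]
  refine Finset.sum_congr rfl fun j _ => ?_
  simp_rw [div_eq_mul_inv]
  rw [lintegral_mul_const _ (hmj j)]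
  congr 1
  rw [← withDensity_apply _ hS, ← map_add_stdGaussian, Measure.map_apply (by fun_prop) hS]
  rfl

/-- Convexity of `s ↦ 1 / s`. It replaces the mixture in the denominator, which has no closed-form
integrals, by single Gaussians. -/
lemma sq_div_mixture_le [NeZero n] (v : Fin n → Param p) (x : Param p) {c : ℝ} (hc : 0 ≤ c) :
    c / mixture v x ≤ (∑ j, c / gaussianShift (v j) x) / n := by
  have hn : (0 : ℝ) < n := by exact_mod_cast Nat.pos_of_ne_zero (NeZero.ne n)
  have h := Finset.sq_sum_div_le_sum_sq_div Finset.univ (fun _ : Fin n => (1 : ℝ))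
    (g := fun j => gaussianShift (v j) x) fun j _ => gaussianShift_pos _ _
  simp only [Finset.sum_const, Finset.card_univ, Fintype.card_fin, nsmul_eq_mul, mul_one,
    one_pow] at h
  have e : c / mixture v x = c * ((n : ℝ) ^ 2 / ∑ j, gaussianShift (v j) x) / n := by
    unfold mixture; field_simp
  have e' : ∑ j, c / gaussianShift (v j) x = c * ∑ j, 1 / gaussianShift (v j) x := by
    rw [Finset.mul_sum]; exact Finset.sum_congr rfl fun j _ => by ring
  rw [e, e']
  gcongr

/-- The remainder term in the expansion of the moments of the likelihood ratio. -/
def mixtureRemainder (w₁ w₂ : Param p) (v : Fin n → Param p) (m : ℝ) (x : Param p) : ℝ :=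
  (∑ j, (gaussianShift w₁ x - gaussianShift w₂ x) ^ 2 *
    (gaussianShift w₁ x / gaussianShift w₂ x) ^ m / gaussianShift (v j) x) / n

lemma integrable_mixtureRemainder (w₁ w₂ : Param p) (v : Fin n → Param p) (m : ℝ) :
    Integrable (mixtureRemainder w₁ w₂ v m) (stdGaussian (Param p)) := by
  unfold mixtureRemainder
  simp_rw [sq_sub_mul_div_rpow_div_eq (gaussianShift_pos _ _) (gaussianShift_pos _ _)]
  refine (integrable_finsetSum _ fun j _ => ?_).div_const _
  exact ((integrable_gaussianShift_rpow_mul_div _ _ _ _).sub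
    ((integrable_gaussianShift_rpow_mul_div _ _ _ _).const_mul 2)).add
    (integrable_gaussianShift_rpow_mul_div _ _ _ _)

lemma integral_mixtureRemainder_le [NeZero n] (w₁ w₂ : Param p) (v : Fin n → Param p) {m S : ℝ}
    (hS : ∀ j, gaussianMoment (inner ℝ (w₂ - v j) (w₁ - w₂)) (‖w₂ - v j‖ ^ 2) (‖w₁ - w₂‖ ^ 2)
        (m + 2) - 2 * gaussianMoment (inner ℝ (w₂ - v j) (w₁ - w₂)) (‖w₂ - v j‖ ^ 2)
        (‖w₁ - w₂‖ ^ 2) (m + 1) + gaussianMoment (inner ℝ (w₂ - v j) (w₁ - w₂)) (‖w₂ - v j‖ ^ 2)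
        (‖w₁ - w₂‖ ^ 2) m ≤ S) :
    ∫ x, mixtureRemainder w₁ w₂ v m x ∂(stdGaussian (Param p)) ≤ S := by
  have hn : (0 : ℝ) < n := by exact_mod_cast Nat.pos_of_ne_zero (NeZero.ne n)
  unfold mixtureRemainder
  simp_rw [sq_sub_mul_div_rpow_div_eq (gaussianShift_pos _ _) (gaussianShift_pos _ _)]
  rw [integral_div, integral_finsetSum, div_le_iff₀ hn]
  · refine (Finset.sum_le_sum (g := fun _ => S) fun j _ => ?_).trans (by simp [mul_comm])
    rw [integral_add, integral_sub, integral_const_mul, integral_gaussianShift_rpow_mul_div,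
      integral_gaussianShift_rpow_mul_div, integral_gaussianShift_rpow_mul_div]
    · exact hS j
    · exact integrable_gaussianShift_rpow_mul_div _ _ _ _
    · exact (integrable_gaussianShift_rpow_mul_div _ _ _ _).const_mul 2
    · exact (integrable_gaussianShift_rpow_mul_div _ _ _ _).sub
        ((integrable_gaussianShift_rpow_mul_div _ _ _ _).const_mul 2)
    · exact integrable_gaussianShift_rpow_mul_div _ _ _ _
  · exact fun j _ => ((integrable_gaussianShift_rpow_mul_div _ _ _ _).sub
      ((integrable_gaussianShift_rpow_mul_div _ _ _ _).const_mul 2)).add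
      (integrable_gaussianShift_rpow_mul_div _ _ _ _)

variable {v v' : Fin n → Param p} {i : Fin n}

lemma mixture_sub_mixture (hv : ∀ j, j ≠ i → v j = v' j) (x : Param p) :
    mixture v x - mixture v' x =
      (gaussianShift (v i) x - gaussianShift (v' i) x) / n := by
  rw [mixture, mixture, ← sub_div, ← Finset.sum_sub_distrib,
    Finset.sum_eq_single i (fun j _ hj => by rw [hv j hj, sub_self]) (by simp)]

/-- The two sums share all terms but one, so the ratio is a mediant of `1` and the ratio of the
differing terms. -/
lemma mixture_div_mixture_le [NeZero n] (hv : ∀ j, j ≠ i → v j = v' j) (x : Param p) :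
    mixture v x / mixture v' x ≤ max 1 (gaussianShift (v i) x / gaussianShift (v' i) x) := by
  have hn : (0 : ℝ) < n := by exact_mod_cast Nat.pos_of_ne_zero (NeZero.ne n)
  have hs := mixture_sub_mixture hv x
  have hq := mixture_pos v' x
  have h1 := gaussianShift_pos (v i) x
  have h2 := gaussianShift_pos (v' i) x
  have hle : gaussianShift (v' i) x / n ≤ mixture v' x :=
    div_le_div_of_nonneg_right (Finset.single_le_sum (f := fun j => gaussianShift (v' j) x)
      (fun j _ => (gaussianShift_pos _ _).le) (Finset.mem_univ i)) hn.le
  rcases le_total (gaussianShift (v i) x) (gaussianShift (v' i) x) with h | h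
  · refine le_max_of_le_left ((div_le_one hq).2 ?_)
    have : (gaussianShift (v i) x - gaussianShift (v' i) x) / n ≤ 0 :=
      div_nonpos_of_nonpos_of_nonneg (by linarith) hn.le
    linarith
  · refine le_max_of_le_right ?_
    rw [div_le_div_iff₀ hq h2]
    have e : mixture v x = mixture v' x +
      (gaussianShift (v i) x - gaussianShift (v' i) x) / n := by linarith
    rw [e]
    have := mul_le_mul_of_nonneg_left hle (sub_nonneg.2 h)
    have e2 : (gaussianShift (v i) x - gaussianShift (v' i) x) * (gaussianShift (v' i) x / n) =
      (gaussianShift (v i) x - gaussianShift (v' i) x) / n * gaussianShift (v' i) x := by ring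
    linarith

lemma sq_mixture_sub_div_le [NeZero n] (hv : ∀ j, j ≠ i → v j = v' j) (m : ℝ) (x : Param p) :
    (mixture v x - mixture v' x) ^ 2 / mixture v' x *
        (gaussianShift (v i) x / gaussianShift (v' i) x) ^ m ≤
      mixtureRemainder (v i) (v' i) v' m x / n ^ 2 := by
  have hr : 0 ≤ (gaussianShift (v i) x / gaussianShift (v' i) x) ^ m :=
    Real.rpow_nonneg (div_pos (gaussianShift_pos _ _) (gaussianShift_pos _ _)).le _
  have := sq_div_mixture_le v' x (mul_nonneg
    (sq_nonneg (gaussianShift (v i) x - gaussianShift (v' i) x)) hr)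
  rw [mixture_sub_mixture hv, div_pow]
  calc _ = (gaussianShift (v i) x - gaussianShift (v' i) x) ^ 2 *
        (gaussianShift (v i) x / gaussianShift (v' i) x) ^ m / mixture v' x / n ^ 2 := by ring
    _ ≤ _ := div_le_div_of_nonneg_right this (by positivity)

/-- Both mixtures have integral one, so the linear term of the expansion contributes nothing. -/
lemma lintegral_ofReal_le_of_le_expansion [NeZero n] {a K : ℝ} {h R : Param p → ℝ}
    (hR : Integrable R (stdGaussian (Param p)))
    (hRK : ∫ x, R x ∂(stdGaussian (Param p)) ≤ K) (h0 : ∀ x, 0 ≤ h x)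
    (hle : ∀ x, h x ≤ mixture v' x + a * (mixture v x - mixture v' x) + R x) :
    ∫⁻ x, ENNReal.ofReal (h x) ∂(stdGaussian (Param p)) ≤ ENNReal.ofReal (1 + K) := by
  have hi := ((integrable_mixture v').add
    (((integrable_mixture v).sub (integrable_mixture v')).const_mul a)).add hR
  calc ∫⁻ x, ENNReal.ofReal (h x) ∂(stdGaussian (Param p))
      ≤ ∫⁻ x, ENNReal.ofReal (mixture v' x + a * (mixture v x - mixture v' x) + R x)
          ∂(stdGaussian (Param p)) := lintegral_mono fun x => ENNReal.ofReal_le_ofReal (hle x)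
    _ = ENNReal.ofReal (∫ x, (mixture v' x + a * (mixture v x - mixture v' x) + R x)
          ∂(stdGaussian (Param p))) :=
        (ofReal_integral_eq_lintegral_ofReal hi
          (Filter.Eventually.of_forall fun x => (h0 x).trans (hle x))).symm
    _ ≤ _ := by
        refine ENNReal.ofReal_le_ofReal ?_
        rw [integral_add, integral_add, integral_const_mul, integral_sub, integral_mixture,
          integral_mixture]
        · linarith
        · exact integrable_mixture v
        · exact integrable_mixture v'
        · exact integrable_mixture v'
        · exact ((integrable_mixture v).sub (integrable_mixture v')).const_mul a
        · exact (integrable_mixture v').add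
            (((integrable_mixture v).sub (integrable_mixture v')).const_mul a)
        · exact hR

/-- For `a = 2` the expansion `P ^ 2 / Q = Q + 2 (P - Q) + (P - Q) ^ 2 / Q` is exact, so no power of
the likelihood ratio enters the remainder. -/
lemma lintegral_mixture_two_le [NeZero n] (hv : ∀ j, j ≠ i → v j = v' j) {t : ℝ}
    (h₁₂ : ‖v i - v' i‖ ^ 2 ≤ t) (h₁ : ∀ j, ‖v i - v' j‖ ^ 2 ≤ t)
    (h₂ : ∀ j, ‖v' i - v' j‖ ^ 2 ≤ t) :
    ∫⁻ x, ENNReal.ofReal (mixture v x ^ (2 : ℝ) * mixture v' x ^ (1 - 2 : ℝ))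
      ∂(stdGaussian (Param p)) ≤
      ENNReal.ofReal (1 + 2 * Real.exp (t / 2) * (Real.exp (t / 2) - 1) / n ^ 2) := by
  have hn : (0 : ℝ) < n := by exact_mod_cast Nat.pos_of_ne_zero (NeZero.ne n)
  refine lintegral_ofReal_le_of_le_expansion (v := v) (v' := v') (a := 2)
    ((integrable_mixtureRemainder (v i) (v' i) v' 0).div_const ((n : ℝ) ^ 2)) ?_ ?_ ?_
  · rw [integral_div]
    refine div_le_div_of_nonneg_right (integral_mixtureRemainder_le _ _ _ fun j => ?_)
      (by positivity)
    have e : ‖v i - v' j‖ ^ 2 = ‖v' i - v' j‖ ^ 2 +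
        2 * inner ℝ (v' i - v' j) (v i - v' i) + ‖v i - v' i‖ ^ 2 := by
      rw [← norm_add_sq_real]; congr 2; abel
    rw [zero_add, zero_add]
    refine gaussianMoment_second_diff_zero_le (sq_nonneg _) h₁₂ (h₂ j) ?_ ?_
    · rw [← e]; positivity
    · rw [← e]; exact h₁ j
  · exact fun x => (mul_pos (Real.rpow_pos_of_pos (mixture_pos v x) _)
      (Real.rpow_pos_of_pos (mixture_pos v' x) _)).le
  · intro x
    have h := sq_mixture_sub_div_le hv 0 x
    have hq := mixture_pos v' x
    rw [Real.rpow_zero, mul_one] at h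
    refine le_trans (le_of_eq ?_) (add_le_add le_rfl h)
    rw [show (1 - 2 : ℝ) = -1 by norm_num, Real.rpow_neg_one, Real.rpow_two]
    field_simp
    ring

lemma lintegral_mixture_rpow_le [NeZero n] (hv : ∀ j, j ≠ i → v j = v' j) {a t : ℝ}
    (ha : 2 ≤ a) (h₁₂ : ‖v i - v' i‖ ^ 2 ≤ t) (h₂ : ∀ j, ‖v' i - v' j‖ ^ 2 ≤ t)
    (ht : t ≤ 1 / 8) (hat : (a - 1) ^ 2 * t ≤ 1 / 8) :
    ∫⁻ x, ENNReal.ofReal (mixture v x ^ a * mixture v' x ^ (1 - a))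
      ∂(stdGaussian (Param p)) ≤ ENNReal.ofReal (1 + 1 / n ^ 2) := by
  have hn : (0 : ℝ) < n := by exact_mod_cast Nat.pos_of_ne_zero (NeZero.ne n)
  have ht0 : 0 ≤ t := (sq_nonneg _).trans h₁₂
  have hrem : ∀ m, 0 ≤ m → (m + 1) ^ 2 * t ≤ 1 / 8 →
      ∫ x, mixtureRemainder (v i) (v' i) v' m x ∂(stdGaussian (Param p)) ≤ 2 * t :=
    fun m hm hmt => integral_mixtureRemainder_le _ _ _ fun j => by
      refine gaussianMoment_second_diff_le_of_small hm (sq_nonneg _) h₁₂ (h₂ j) ?_ ht hmt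
      refine (abs_real_inner_le_norm _ _).trans ?_
      have h1 := h₂ j
      nlinarith [sq_nonneg (‖v' i - v' j‖ - ‖v i - v' i‖)]
  have hi := fun m => integrable_mixtureRemainder (v i) (v' i) v' m
  have hc : 0 ≤ a * (a - 1) / (n : ℝ) ^ 2 :=
    div_nonneg (mul_nonneg (by linarith) (by linarith)) (by positivity)
  refine lintegral_ofReal_le_of_le_expansion (v := v) (v' := v') (a := a)
    (((hi 0).add (hi (a - 2))).const_mul (a * (a - 1) / (n : ℝ) ^ 2)) ?_ ?_ ?_
  · have h0 := hrem 0 le_rfl (by linarith)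
    have hm := hrem (a - 2) (by linarith) (by rw [show a - 2 + 1 = a - 1 by ring]; exact hat)
    have e : ∫ x, a * (a - 1) / (n : ℝ) ^ 2 * (mixtureRemainder (v i) (v' i) v' 0 +
        mixtureRemainder (v i) (v' i) v' (a - 2)) x ∂(stdGaussian (Param p)) =
        a * (a - 1) / (n : ℝ) ^ 2 * (∫ x, mixtureRemainder (v i) (v' i) v' 0 x
          ∂(stdGaussian (Param p)) +
        ∫ x, mixtureRemainder (v i) (v' i) v' (a - 2) x ∂(stdGaussian (Param p))) := by
      rw [integral_const_mul, ← integral_add (hi 0) (hi _)]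
      rfl
    rw [e]
    calc _ ≤ a * (a - 1) / (n : ℝ) ^ 2 * (4 * t) :=
          mul_le_mul_of_nonneg_left (by linarith) hc
      _ = (a * (a - 1) * (4 * t)) / (n : ℝ) ^ 2 := by ring
      _ ≤ 1 / (n : ℝ) ^ 2 := by
        refine div_le_div_of_nonneg_right ?_ (by positivity)
        -- `a ≤ 2 * (a - 1)` because `a ≥ 2`; with `(a - 1) ^ 2 * t ≤ 1 / 8` the whole remainder is
        -- at most `1 / n ^ 2`.
        have : a * (a - 1) * t ≤ 2 * (a - 1) ^ 2 * t := by
          apply mul_le_mul_of_nonneg_right _ ht0; nlinarith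
        linarith
  · exact fun x => (mul_pos (Real.rpow_pos_of_pos (mixture_pos v x) _)
      (Real.rpow_pos_of_pos (mixture_pos v' x) _)).le
  · intro x
    have hp := mixture_pos v x
    have hq := mixture_pos v' x
    set P := mixture v x with hP
    set Q := mixture v' x with hQ
    set ρ := gaussianShift (v i) x / gaussianShift (v' i) x with hρ
    have hρ0 : 0 < ρ := div_pos (gaussianShift_pos _ _) (gaussianShift_pos _ _)
    have hr := mixture_div_mixture_le hv x
    -- The two powers of `ρ` correspond to the remainders with `m = 0` and `m = a - 2`.
    have hmax : max 1 ((P / Q) ^ (a - 2)) ≤ ρ ^ (0 : ℝ) + ρ ^ (a - 2) := by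
      have h1 : 0 < ρ ^ (a - 2) := Real.rpow_pos_of_pos hρ0 _
      rw [Real.rpow_zero]
      refine max_le (by linarith) ?_
      rcases le_total ρ 1 with h | h
      · have : P / Q ≤ 1 := hr.trans (max_le le_rfl h)
        have := Real.rpow_le_one (div_pos hp hq).le this (show 0 ≤ a - 2 by linarith)
        linarith
      · have : P / Q ≤ ρ := hr.trans (max_le h le_rfl)
        have := Real.rpow_le_rpow (div_pos hp hq).le this (show 0 ≤ a - 2 by linarith)
        linarith
    have hquad := rpow_le_quadratic ha (div_pos hp hq)
    have e1 : P ^ a * Q ^ (1 - a) = Q * (P / Q) ^ a := by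
      rw [Real.div_rpow hp.le hq.le, Real.rpow_sub hq, Real.rpow_one]; ring
    have s0 := sq_mixture_sub_div_le hv 0 x
    have s1 := sq_mixture_sub_div_le hv (a - 2) x
    rw [← hP, ← hQ, ← hρ] at s0 s1
    have haa : 0 ≤ a * (a - 1) := mul_nonneg (by linarith) (by linarith)
    calc P ^ a * Q ^ (1 - a) = Q * (P / Q) ^ a := e1
      _ ≤ Q * (1 + a * (P / Q - 1) + a * (a - 1) * (P / Q - 1) ^ 2 *
            (ρ ^ (0 : ℝ) + ρ ^ (a - 2))) := by
          refine mul_le_mul_of_nonneg_left (hquad.trans ?_) hq.le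
          gcongr
      _ = Q + a * (P - Q) + a * (a - 1) * ((P - Q) ^ 2 / Q * ρ ^ (0 : ℝ) +
            (P - Q) ^ 2 / Q * ρ ^ (a - 2)) := by field_simp
      _ ≤ Q + a * (P - Q) + a * (a - 1) * (mixtureRemainder (v i) (v' i) v' 0 x / n ^ 2 +
            mixtureRemainder (v i) (v' i) v' (a - 2) x / n ^ 2) := by gcongr
      _ = _ := by
          simp only [Pi.add_apply]
          ring

end Mixture

/-! ### Privacy -/

section Privacy

variable {X : Type*} {p n : ℕ} {C : Set (Param p)} {L : ℝ≥0}
  {loss : Param p → X → ℝ} {grad : Param p → X → Param p}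

lemma holderDominated_chainLaw [NeZero n] (h : IsLipschitzERM C L loss grad) {σsq : ℝ}
    {η : ℕ → ℝ} {D D' : Fin n → X} {b : ℝ} (hb : 0 < b) {A : ℝ≥0∞}
    (hA : ∀ r θ, HolderDominated b A (projStep C grad σsq D r θ) (projStep C grad σsq D' r θ))
    (θ : Param p) (k : ℕ) :
    HolderDominated b (A ^ k) (chainLaw C grad σsq η D θ k) (chainLaw C grad σsq η D' θ k) := by
  induction k with
  | zero =>
    rw [pow_zero]
    exact HolderDominated.dirac hb θ
  | succ k ih =>
    rw [pow_succ]
    exact ih.bind hb (measurable_projStep h σsq D _) (measurable_projStep h σsq D' _)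
      (hA (η (k + 1)))

/-- Factoring `σ` out of gradient plus noise puts all dependence on the data into the centers of the
mixture; the outer map depends only on `θ` and `η`, so it is mere post-processing. -/
lemma projStep_eq_map_mixture [NeZero n] (h : IsLipschitzERM C L loss grad) {σsq : ℝ}
    (hσ : 0 < σsq) (D : Fin n → X) (η : ℝ) (θ : Param p) :
    projStep C grad σsq D η θ = ((stdGaussian (Param p)).withDensity fun x => ENNReal.ofReal
      (mixture (fun j => ((n : ℝ) / Real.sqrt σsq) • grad (proj C θ) (D j)) x)).map
        fun y => proj C (proj C θ - (η * Real.sqrt σsq) • y) := by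
  have hs : Real.sqrt σsq ≠ 0 := (Real.sqrt_pos.2 hσ).ne'
  have hp : Measurable (proj C) := (continuous_proj h.nonempty h.isClosed h.convex).measurable
  have hm : Measurable fun ib : Fin n × Param p =>
      ((n : ℝ) / Real.sqrt σsq) • grad (proj C θ) (D ib.1) + ib.2 :=
    measurable_from_prod_countable_right fun i =>
      measurable_const_add (((n : ℝ) / Real.sqrt σsq) • grad (proj C θ) (D i))
  have hm1 : Measurable fun y : Param p => proj C (proj C θ - (η * Real.sqrt σsq) • y) :=
    hp.comp (by fun_prop)
  have hm2 : Measurable fun ib : Fin n × Param p => stepMap C grad D η (θ, ib) :=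
    (measurable_stepMap h D η).comp measurable_prodMk_left
  have hsm : Measurable fun x : Param p => Real.sqrt σsq • x := by fun_prop
  rw [← map_add_eq_withDensity_mixture, Measure.map_map hm1 hm, projStep_eq_map,
    noise_eq_map_stdGaussian hσ.le]
  conv_lhs => rw [← Measure.map_id (μ := uniformOn (Set.univ : Set (Fin n))),
    Measure.map_prod_map _ _ measurable_id hsm]
  rw [Measure.map_map hm2 (measurable_id.prodMap hsm)]
  congr 1
  funext ib
  simp only [Function.comp, stepMap, Prod.map, id]
  congr 2
  simp only [smul_add, smul_smul]
  rw [show η * Real.sqrt σsq * (n / Real.sqrt σsq) = η * n by field_simp]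

lemma holderDominated_projStep [NeZero n] (h : IsLipschitzERM C L loss grad) {σsq : ℝ}
    (hσ : 0 < σsq) (D D' : Fin n → X) (η : ℝ) (θ : Param p) {a b : ℝ}
    (hab : a.HolderConjugate b) {M : ℝ≥0∞}
    (hM : ∫⁻ x, ENNReal.ofReal
      (mixture (fun j => ((n : ℝ) / Real.sqrt σsq) • grad (proj C θ) (D j)) x ^ a *
        mixture (fun j => ((n : ℝ) / Real.sqrt σsq) • grad (proj C θ) (D' j)) x ^ (1 - a))
        ∂(stdGaussian (Param p)) ≤ M) :
    HolderDominated b (M ^ (1 / a)) (projStep C grad σsq D η θ) (projStep C grad σsq D' η θ) := by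
  have hp : Measurable (proj C) := (continuous_proj h.nonempty h.isClosed h.convex).measurable
  rw [projStep_eq_map_mixture h hσ, projStep_eq_map_mixture h hσ]
  exact (HolderDominated.withDensity hab (continuous_mixture _).measurable
    (continuous_mixture _).measurable (mixture_pos _) (mixture_pos _) hM).map
    (hp.comp (by fun_prop))

lemma norm_sq_smul_grad_sub_le (h : IsLipschitzERM C L loss grad) {σsq : ℝ} (hσ : 0 < σsq)
    {θ : Param p} (hθ : θ ∈ C) (d d' : X) :
    ‖((n : ℝ) / Real.sqrt σsq) • grad θ d - ((n : ℝ) / Real.sqrt σsq) • grad θ d'‖ ^ 2 ≤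
      4 * n ^ 2 * (L : ℝ) ^ 2 / σsq := by
  have h1 : ‖grad θ d - grad θ d'‖ ≤ 2 * L := by
    have := norm_sub_le (grad θ d) (grad θ d')
    have := h.norm_grad_le_of_mem d hθ
    have := h.norm_grad_le_of_mem d' hθ
    linarith
  rw [← smul_sub, norm_smul, mul_pow, Real.norm_eq_abs, sq_abs, div_pow, Real.sq_sqrt hσ.le]
  have h2 : ‖grad θ d - grad θ d'‖ ^ 2 ≤ (2 * L) ^ 2 := pow_le_pow_left₀ (norm_nonneg _) h1 2
  calc _ ≤ (n : ℝ) ^ 2 / σsq * (2 * L) ^ 2 := mul_le_mul_of_nonneg_left h2 (by positivity)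
    _ = _ := by ring

lemma one_add_div_sq_pow_le_four {K : ℝ} (hK0 : 0 ≤ K) (hK : K ≤ 1.3) (n : ℕ) [NeZero n] :
    (1 + K / (n : ℝ) ^ 2) ^ (n ^ 2 - 1) ≤ 4 := by
  have hn : (0 : ℝ) < n := by exact_mod_cast Nat.pos_of_ne_zero (NeZero.ne n)
  have h1 : (1 + K / (n : ℝ) ^ 2) ^ (n ^ 2 - 1) ≤ Real.exp (K / (n : ℝ) ^ 2) ^ (n ^ 2) := by
    refine (pow_le_pow_right₀ (le_add_of_nonneg_right (by positivity)) (Nat.sub_le _ 1)).trans ?_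
    refine pow_le_pow_left₀ (by positivity) ?_ _
    linarith [Real.add_one_le_exp (K / (n : ℝ) ^ 2)]
  refine h1.trans ?_
  rw [← Real.exp_nat_mul]
  push_cast
  rw [mul_div_cancel₀ _ (by positivity)]
  have h2 := Real.exp_bound' (x := 0.3) (by norm_num) (by norm_num) (n := 3) (by norm_num)
  have h3 : Real.exp 0.3 ≤ 1.36 := h2.trans (by norm_num [Finset.sum_range_succ, Nat.factorial])
  have h4 := Real.exp_one_lt_d9
  calc Real.exp K ≤ Real.exp (1 + 0.3) := Real.exp_le_exp.2 (by linarith)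
    _ = Real.exp 1 * Real.exp 0.3 := Real.exp_add _ _
    _ ≤ 2.7182818286 * 1.36 := mul_le_mul h4.le h3 (Real.exp_pos _).le (by norm_num)
    _ ≤ 4 := by norm_num

lemma chainLaw_measure_le [NeZero n] (h : IsLipschitzERM C L loss grad) {σsq : ℝ} (hσ : 0 < σsq)
    {η : ℕ → ℝ} {D D' : Fin n → X} {θ₁ : Param p} {a ε x K : ℝ} (ha : 2 ≤ a)
    (hx : x ≤ (a - 1) * ε) (hK0 : 0 ≤ K) (hK : K ≤ 1.3)
    (hM : ∀ θ ∈ C, ∫⁻ x, ENNReal.ofReal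
      (mixture (fun j => ((n : ℝ) / Real.sqrt σsq) • grad θ (D j)) x ^ a *
        mixture (fun j => ((n : ℝ) / Real.sqrt σsq) • grad θ (D' j)) x ^ (1 - a))
        ∂(stdGaussian (Param p)) ≤ ENNReal.ofReal (1 + K / (n : ℝ) ^ 2))
    {S : Set (Param p)} (hS : MeasurableSet S) :
    chainLaw C grad σsq η D θ₁ (n ^ 2 - 1) S ≤ ENNReal.ofReal (Real.exp ε) *
      chainLaw C grad σsq η D' θ₁ (n ^ 2 - 1) S + ENNReal.ofReal (Real.exp (-x)) := by
  have hab : a.HolderConjugate (Real.conjExponent a) := .conjExponent (by linarith)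
  have := isProbabilityMeasure_chainLaw h σsq η D' θ₁ (n ^ 2 - 1)
  refine HolderDominated.measure_le hab ha hx ?_ hS
  refine (holderDominated_chainLaw h hab.symm.pos (fun r θ => holderDominated_projStep h hσ D D' r
    θ hab (hM _ (proj_mem h.nonempty h.isClosed θ))) θ₁ (n ^ 2 - 1)).mono ?_
  -- The root `1 / a` is exchanged with the power, so that the product of the moments themselves is
  -- compared with `4`.
  rw [← ENNReal.rpow_natCast, ← ENNReal.rpow_mul, mul_comm, ENNReal.rpow_mul, ENNReal.rpow_natCast,
    ← ENNReal.ofReal_pow (by positivity)]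
  refine ENNReal.rpow_le_rpow (ENNReal.ofReal_le_ofReal ?_) (by positivity)
  exact one_add_div_sq_pow_le_four hK0 hK n

lemma two_mul_exp_mul_le {t : ℝ} (ht : t ≤ 1 / (2 * Real.log 2)) :
    2 * Real.exp (t / 2) * (Real.exp (t / 2) - 1) ≤ 1.3 := by
  have h1 := Real.log_two_gt_d9
  have h2 : t / 2 ≤ 0.361 := by
    have : 1 / (2 * Real.log 2) ≤ 0.722 := by
      rw [div_le_iff₀ (by linarith)]; linarith
    linarith
  have h3 := Real.exp_bound' (x := 0.361) (by norm_num) (by norm_num) (n := 4) (by norm_num)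
  have h4 : Real.exp (t / 2) ≤ 1.44 := (Real.exp_le_exp.2 h2).trans
    (h3.trans (by norm_num [Finset.sum_range_succ, Nat.factorial]))
  have h5 := Real.exp_pos (t / 2)
  nlinarith

theorem isDifferentiallyPrivate_outputLaw (h : IsLipschitzERM C L loss grad) {ε δ : ℝ}
    (hεδ : AdmissiblePrivacy ε δ) (η : ℕ → ℝ) {θ₁ : Param p} (hθ₁ : θ₁ ∈ C) :
    IsDifferentiallyPrivate
      (fun D : Fin n → X => outputLaw C grad (32 * varianceScale L n ε δ) η θ₁ D) ε δ := by
  obtain ⟨hδ0, hδ1, hε0, hε⟩ := hεδ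
  rintro D D' ⟨i, -, hi⟩ S hS
  have hn0 : n ≠ 0 := fun h0 => by subst h0; exact i.elim0
  have : NeZero n := ⟨hn0⟩
  simp only [outputLaw, iterateLaw_eq_chainLaw h _ η _ hθ₁]
  have triv : ∀ m : ℝ≥0∞, m ≤ ENNReal.ofReal (Real.exp ε) * m + ENNReal.ofReal δ := fun m => by
    have : 1 ≤ ENNReal.ofReal (Real.exp ε) :=
      ENNReal.one_le_ofReal.2 (Real.one_le_exp hε0.le)
    calc m = 1 * m := (one_mul m).symm
      _ ≤ ENNReal.ofReal (Real.exp ε) * m := by gcongr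
      _ ≤ _ := le_self_add
  -- For `n = 1` no update takes place. It is set aside because the case `log (1 / δ) ≤ ε` needs
  -- `log (n / δ) ≥ log 2`.
  by_cases hn1 : n = 1
  · subst hn1
    exact triv _
  -- Here the variance is zero and the rescaling by `σ` impossible, but all gradients on `C` vanish
  -- and the data have no influence.
  by_cases hL : L = 0
  · have hstep : ∀ σsq r, projStep C grad σsq D r = projStep C grad σsq D' r := fun σsq r => by
      funext θ
      have hg : ∀ d, grad (proj C θ) d = 0 := fun d => by
        have := h.norm_grad_le_of_mem d (proj_mem h.nonempty h.isClosed θ)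
        rw [hL] at this
        exact norm_le_zero_iff.1 (by simpa using this)
      simp only [projStep_eq_map, stepMap, hg]
    have hchain : ∀ k, chainLaw C grad (32 * varianceScale L n ε δ) η D θ₁ k =
        chainLaw C grad (32 * varianceScale L n ε δ) η D' θ₁ k := fun k => by
      induction k with
      | zero => rfl
      | succ k ih => rw [chainLaw, chainLaw, ih, hstep]
    rw [hchain]
    exact triv _
  have hL0 : (0 : ℝ) < L := by
    have := pos_iff_ne_zero.2 hL
    exact_mod_cast this
  have hn2 : (2 : ℝ) ≤ n := by exact_mod_cast (by omega : 2 ≤ n)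
  have hn : (0 : ℝ) < n := by linarith
  set x := Real.log (1 / δ) with hx
  set Λ := Real.log (n / δ) with hΛ
  have hx0 : 0 < x := Real.log_pos (by rw [lt_div_iff₀ hδ0]; linarith)
  have hΛx : Λ = Real.log n + x := by
    rw [hΛ, hx, ← Real.log_mul hn.ne' (by positivity)]; congr 1; ring
  have hlog2 : Real.log 2 ≤ Real.log n := Real.log_le_log (by norm_num) hn2
  have hl2 : 0 < Real.log 2 := Real.log_pos (by norm_num)
  have hΛ0 : 0 < Λ := by linarith
  have hex : Real.exp (-x) = δ := by
    rw [hx, one_div, Real.log_inv, neg_neg, Real.exp_log hδ0]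
  have hε2 : ε ^ 2 ≤ 4 * x := by
    have := pow_le_pow_left₀ hε0.le hε 2
    rw [mul_pow, Real.sq_sqrt hx0.le] at this
    linarith
  set σsq := 32 * varianceScale L n ε δ with hσsq
  have hσ : σsq = 32 * ((L : ℝ) ^ 2 * n ^ 2 * Λ * x / ε ^ 2) := rfl
  have hσ0 : 0 < σsq := by rw [hσ]; positivity
  -- The bound `(2 * L * n / σ) ^ 2` for the squared distances of the centers.
  set t := ε ^ 2 / (8 * Λ * x) with ht
  have htσ : 4 * (n : ℝ) ^ 2 * (L : ℝ) ^ 2 / σsq = t := by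
    rw [hσ, ht]; field_simp; ring
  have hv : ∀ θ : Param p, ∀ j, j ≠ i → ((n : ℝ) / Real.sqrt σsq) • grad θ (D j) =
      ((n : ℝ) / Real.sqrt σsq) • grad θ (D' j) := fun θ j hj => by rw [hi j hj]
  have hdist : ∀ θ ∈ C, ∀ d d', ‖((n : ℝ) / Real.sqrt σsq) • grad θ d -
      ((n : ℝ) / Real.sqrt σsq) • grad θ d'‖ ^ 2 ≤ t := fun θ hθ d d' =>
    (norm_sq_smul_grad_sub_le h hσ0 hθ d d').trans htσ.le
  rw [← hex]
  -- If `x ≤ ε`, order `2` suffices and `ε ^ 2 ≤ 4 * x` bounds `t` by `1 / (2 * log 2)`. If `ε ≤ x`,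
  -- the order `x / ε + 1` gives `(a - 1) ^ 2 * t = x / (8 * Λ) ≤ 1 / 8`.
  rcases le_total x ε with hxε | hxε
  · have ht0 : 0 ≤ t := by positivity
    refine chainLaw_measure_le h hσ0 (a := 2) le_rfl (by linarith)
      (K := 2 * Real.exp (t / 2) * (Real.exp (t / 2) - 1)) ?_ (two_mul_exp_mul_le ?_) ?_ hS
    · have := Real.one_le_exp (show 0 ≤ t / 2 by positivity)
      exact mul_nonneg (by positivity) (by linarith)
    · calc t ≤ 4 * x / (8 * Λ * x) := div_le_div_of_nonneg_right hε2 (by positivity)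
        _ = 1 / (2 * Λ) := by field_simp; norm_num
        _ ≤ _ := one_div_le_one_div_of_le (by positivity) (by linarith)
    · intro θ hθ
      exact lintegral_mixture_two_le (hv θ) (hdist θ hθ _ _) (fun j => hdist θ hθ _ _)
        (fun j => hdist θ hθ _ _)
  · have hr : 1 ≤ x / ε := (one_le_div hε0).2 hxε
    have hrt : (x / ε) ^ 2 * t ≤ 1 / 8 := by
      have : (x / ε) ^ 2 * t = x / Λ / 8 := by rw [ht]; field_simp
      rw [this]
      have : x / Λ ≤ 1 := (div_le_one hΛ0).2 (by linarith)
      linarith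
    have ht0 : 0 ≤ t := by positivity
    refine chainLaw_measure_le h hσ0 (a := x / ε + 1) (K := 1) (by linarith) ?_ (by norm_num)
      (by norm_num) ?_ hS
    · rw [add_sub_cancel_right, div_mul_cancel₀ _ hε0.ne']
    · intro θ hθ
      refine lintegral_mixture_rpow_le (hv θ) (by linarith) (hdist θ hθ _ _)
        (fun j => hdist θ hθ _ _) ?_ (by rwa [add_sub_cancel_right])
      exact (le_mul_of_one_le_left ht0 (one_le_pow₀ hr)).trans hrt

end Privacy

/-! ### Deterministic part of the last-iterate analysis -/

section Sequences

/-- From averages to the last iterate (Shamir–Zhang): `β j` controls how far the average of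
`a j, …, a N` may exceed `a j`. -/
lemma last_le_average_add {a β : ℕ → ℝ} {N : ℕ}
    (h : ∀ j < N, ∑ k ∈ Finset.range (N + 1 - j), (a (j + k) - a j) ≤ β j) :
    a N ≤ (∑ k ∈ Finset.range (N + 1), a k) / (N + 1) +
      ∑ j ∈ Finset.range N, β j / (((N : ℝ) + 1 - j) * (N - j)) := by
  have key : ∀ j ≤ N, (∑ k ∈ Finset.range (N + 1 - j), a (j + k)) / ((N : ℝ) + 1 - j) ≤
      (∑ k ∈ Finset.range (N + 1), a k) / (N + 1) +
      ∑ i ∈ Finset.range j, β i / (((N : ℝ) + 1 - i) * (N - i)) := by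
    intro j
    induction j with
    | zero => simp
    | succ j ih =>
      intro hj
      have hjN : (j : ℝ) + 1 ≤ N := by exact_mod_cast hj
      have ih := ih (by omega)
      have hb := h j (by omega)
      have e1 : N + 1 - j = (N + 1 - (j + 1)) + 1 := by omega
      rw [Finset.sum_sub_distrib, Finset.sum_const, Finset.card_range, nsmul_eq_mul,
        Nat.cast_sub (by omega)] at hb
      push_cast at hb
      have e2 : ∑ k ∈ Finset.range (N + 1 - j), a (j + k) =
          ∑ k ∈ Finset.range (N + 1 - (j + 1)), a (j + 1 + k) + a j := by
        rw [e1, Finset.sum_range_succ']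
        simp [add_comm, add_left_comm]
      rw [Finset.sum_range_succ (n := j)]
      set S := ∑ k ∈ Finset.range (N + 1 - (j + 1)), a (j + 1 + k) with hS
      rw [e2] at hb ih
      have hm : (0 : ℝ) < N - j := by linarith
      have hm1 : (0 : ℝ) < N + 1 - j := by linarith
      push_cast
      have e3 : (N : ℝ) + 1 - (j + 1) = N - j := by ring
      rw [e3]
      -- Dropping `a j` from the average changes it by exactly `(S - (N - j) * a j) / ((N + 1 - j) *
      -- (N - j))`, and `hb` bounds the numerator by `β j`.
      have h4 : S / (N - j) ≤ (S + a j) / ((N : ℝ) + 1 - j) +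
          β j / (((N : ℝ) + 1 - j) * (N - j)) := by
        rw [div_add_div _ _ hm1.ne' (by positivity), div_le_div_iff₀ hm (by positivity)]
        have h5 : (S + a j) * (N - j) + β j ≥ S * (N + 1 - j) := by linarith
        have h6 := mul_le_mul_of_nonneg_left h5 (show 0 ≤ ((N : ℝ) + 1 - j) * (N - j) by positivity)
        linarith
      linarith
  have := key N le_rfl
  simpa using this

lemma sum_inv_sub_le (N : ℕ) (hN : 1 ≤ N) :
    ∑ j ∈ Finset.range N, 1 / ((N : ℝ) - j) ≤ 1 + Real.log N := by
  have h1 := harmonic_le_one_add_log N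
  have h2 : ∑ j ∈ Finset.range N, 1 / ((N : ℝ) - j) = ∑ j ∈ Finset.range N, ((j : ℝ) + 1)⁻¹ := by
    rw [← Finset.sum_range_reflect]
    refine Finset.sum_congr rfl fun j hj => ?_
    have : j < N := Finset.mem_range.1 hj
    rw [Nat.cast_sub (by omega), Nat.cast_sub (by omega), one_div]
    congr 1; push_cast; ring
  rw [h2]
  simpa [harmonic] using h1

/-- Multiplying the recursion by `√(j + k + 1)` makes the coefficient of `g k` constant, and the
growth of the weight is paid by `e k ≤ R ^ 2`. The condition `√j * e 0 = 0` covers both uses: a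
whole run (`j = 0`) with any comparator, and a tail whose comparator is its own starting point (`e 0
= 0`). -/
lemma sum_le_of_sqrt_rate {e g : ℕ → ℝ} {c G R : ℝ} (hc : 0 < c) (j : ℕ)
    (he : ∀ k, e k ≤ R ^ 2) (hj : Real.sqrt j * e 0 = 0) (hpos : ∀ k, 0 ≤ e k)
    (h : ∀ k, e (k + 1) ≤ e k - 2 * (c / Real.sqrt ((j + k + 1 : ℕ))) * g k +
      (c / Real.sqrt ((j + k + 1 : ℕ))) ^ 2 * G ^ 2) (m : ℕ) :
    2 * c * ∑ k ∈ Finset.range m, g k ≤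
      (R ^ 2 + 2 * c ^ 2 * G ^ 2) * (Real.sqrt ((j + m : ℕ)) - Real.sqrt j) := by
  have key : 2 * c * ∑ k ∈ Finset.range m, g k ≤ (R ^ 2 + 2 * c ^ 2 * G ^ 2) *
      (Real.sqrt ((j + m : ℕ)) - Real.sqrt j) - Real.sqrt ((j + m : ℕ)) * e m := by
    induction m with
    | zero => simp [hj]
    | succ m ih =>
      rw [Finset.sum_range_succ, ← add_assoc]
      set s := Real.sqrt ((j + m : ℕ)) with hs
      set r := Real.sqrt ((j + m + 1 : ℕ)) with hr
      have hr0 : 0 < r := Real.sqrt_pos.2 (by positivity)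
      have hs0 : 0 ≤ s := Real.sqrt_nonneg _
      have hsr : s ≤ r := Real.sqrt_le_sqrt (by push_cast; linarith)
      have hsq : r ^ 2 = s ^ 2 + 1 := by
        rw [hr, hs, Real.sq_sqrt (by positivity), Real.sq_sqrt (by positivity)]; push_cast; ring
      have h1 := mul_le_mul_of_nonneg_left (h m) hr0.le
      rw [← hr] at h1
      have e1 : r * (e m - 2 * (c / r) * g m + (c / r) ^ 2 * G ^ 2) =
          r * e m - 2 * c * g m + c ^ 2 * G ^ 2 / r := by field_simp
      rw [e1] at h1
      -- From `(r - s) * (r + s) = 1` and `s ≤ r`.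
      have h2 : 1 / r ≤ 2 * (r - s) := by
        rw [div_le_iff₀ hr0]
        nlinarith
      have h3 : c ^ 2 * G ^ 2 / r ≤ c ^ 2 * G ^ 2 * (2 * (r - s)) := by
        rw [div_eq_mul_one_div]; exact mul_le_mul_of_nonneg_left h2 (by positivity)
      have h4 : (r - s) * e m ≤ (r - s) * R ^ 2 :=
        mul_le_mul_of_nonneg_left (he m) (by linarith)
      linarith
  have : 0 ≤ Real.sqrt ((j + m : ℕ)) * e m := mul_nonneg (Real.sqrt_nonneg _) (hpos m)
  linarith

/-- With the weight `t = j + k + 1` the contraction factor `1 - 1 / t` becomes `t - 1`, the previous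
weight, so the distances telescope without using a diameter. Here `G` stands for the second moment
itself, not its root. -/
lemma sum_le_of_inv_rate {e g : ℕ → ℝ} {μ G : ℝ} (hμ : 0 < μ) (j : ℕ)
    (hj : (j : ℝ) * e 0 = 0) (hpos : ∀ k, 0 ≤ e k)
    (h : ∀ k, e (k + 1) ≤ (1 - 1 / (μ * (j + k + 1 : ℕ)) * μ) * e k -
      2 * (1 / (μ * (j + k + 1 : ℕ))) * g k + (1 / (μ * (j + k + 1 : ℕ))) ^ 2 * G) (m : ℕ) :
    ∑ k ∈ Finset.range m, g k ≤
      G / (2 * μ) * ∑ k ∈ Finset.range m, 1 / ((j : ℝ) + k + 1) := by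
  have key : 2 / μ * ∑ k ∈ Finset.range m, g k ≤
      G / μ ^ 2 * ∑ k ∈ Finset.range m, 1 / ((j : ℝ) + k + 1) - (j + m) * e m := by
    induction m with
    | zero => simp [hj]
    | succ m ih =>
      rw [Finset.sum_range_succ, Finset.sum_range_succ]
      have ht : (0 : ℝ) < j + m + 1 := by positivity
      have h1 := mul_le_mul_of_nonneg_left (h m) ht.le
      push_cast at h1 ⊢
      have e1 : ((j : ℝ) + m + 1) * ((1 - 1 / (μ * (j + m + 1)) * μ) * e m -
          2 * (1 / (μ * (j + m + 1))) * g m + (1 / (μ * (j + m + 1))) ^ 2 * G) =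
          (j + m) * e m - 2 / μ * g m + G / μ ^ 2 * (1 / (j + m + 1)) := by
        field_simp; ring
      rw [e1] at h1
      linarith
  have h0 : 0 ≤ ((j : ℝ) + m) * e m := mul_nonneg (by positivity) (hpos m)
  have h2 : 2 / μ * ∑ k ∈ Finset.range m, g k ≤
      2 / μ * (G / (2 * μ) * ∑ k ∈ Finset.range m, 1 / ((j : ℝ) + k + 1)) := by
    have : 2 / μ * (G / (2 * μ) * ∑ k ∈ Finset.range m, 1 / ((j : ℝ) + k + 1)) =
      G / μ ^ 2 * ∑ k ∈ Finset.range m, 1 / ((j : ℝ) + k + 1) := by field_simp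
    linarith
  exact le_of_mul_le_mul_left h2 (by positivity)

/-- Last-iterate bound for the learning rate `c / √t`. -/
lemma last_le_of_sqrt_rate {a : ℕ → ℝ} {N : ℕ} {B : ℝ} (hB : 0 ≤ B) (hN : 1 ≤ N)
    (h0 : ∑ k ∈ Finset.range (N + 1), a k ≤ B * Real.sqrt ((N + 1 : ℕ)))
    (h : ∀ j < N, ∑ k ∈ Finset.range (N + 1 - j), (a (j + k) - a j) ≤
      B * (Real.sqrt ((N + 1 : ℕ)) - Real.sqrt j)) :
    a N ≤ B * (2 + Real.log N) / Real.sqrt ((N + 1 : ℕ)) := by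
  have hN' : (0 : ℝ) < N := by exact_mod_cast hN
  set r := Real.sqrt ((N + 1 : ℕ)) with hr
  have hr0 : 0 < r := Real.sqrt_pos.2 (by positivity)
  have hr2 : r ^ 2 = N + 1 := by rw [hr, Real.sq_sqrt (by positivity)]; push_cast; ring
  refine (last_le_average_add h).trans ?_
  have h1 : (∑ k ∈ Finset.range (N + 1), a k) / (N + 1) ≤ B / r := by
    rw [← hr2, div_le_div_iff₀ (by positivity) hr0]
    calc _ ≤ B * r * r := mul_le_mul_of_nonneg_right h0 hr0.le
      _ = _ := by ring
  have h2 : ∑ j ∈ Finset.range N, B * (r - Real.sqrt j) / (((N : ℝ) + 1 - j) * (N - j)) ≤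
      B / r * ∑ j ∈ Finset.range N, 1 / ((N : ℝ) - j) := by
    rw [Finset.mul_sum]
    refine Finset.sum_le_sum fun j hj => ?_
    have hj' : (j : ℝ) + 1 ≤ N := by exact_mod_cast Finset.mem_range.1 hj
    have hm : (0 : ℝ) < N - j := by linarith
    have hm1 : (0 : ℝ) < N + 1 - j := by linarith
    have hsj : Real.sqrt j ^ 2 = j := Real.sq_sqrt (by positivity)
    have hsj0 := Real.sqrt_nonneg (j : ℝ)
    have hle : Real.sqrt j ≤ r := Real.sqrt_le_sqrt (by push_cast; linarith)
    rw [div_mul_div_comm, mul_one, div_le_div_iff₀ (by positivity) (by positivity)]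
    -- `(r - √j) * r ≤ (r - √j) * (r + √j) = r ^ 2 - j`; this cancels one factor of the denominator
    -- and leaves a harmonic sum.
    have h3 : (r - Real.sqrt j) * r ≤ N + 1 - j := by nlinarith
    have h4 := mul_le_mul_of_nonneg_left h3 (mul_nonneg hB hm.le)
    linarith
  have h3 := mul_le_mul_of_nonneg_left (sum_inv_sub_le N hN) (show 0 ≤ B / r by positivity)
  calc _ ≤ B / r + B / r * (1 + Real.log N) := add_le_add h1 (h2.trans h3)
    _ = _ := by ring

/-- Last-iterate bound for the learning rate `1 / (μ t)`. -/
lemma last_le_of_inv_rate {a : ℕ → ℝ} {N : ℕ} {B : ℝ} (hB : 0 ≤ B) (hN : 1 ≤ N)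
    (h0 : ∑ k ∈ Finset.range (N + 1), a k ≤
      B * ∑ k ∈ Finset.range (N + 1), 1 / ((k : ℝ) + 1))
    (h : ∀ j < N, ∑ k ∈ Finset.range (N + 1 - j), (a (j + k) - a j) ≤
      B * ∑ k ∈ Finset.range (N + 1 - j), 1 / ((j : ℝ) + k + 1)) :
    a N ≤ 3 * B * (1 + Real.log (N + 1)) / (N + 1) := by
  have hN' : (0 : ℝ) < N := by exact_mod_cast hN
  refine (last_le_average_add h).trans ?_
  have hH : ∑ k ∈ Finset.range (N + 1), 1 / ((k : ℝ) + 1) ≤ 1 + Real.log (N + 1) := by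
    have := harmonic_le_one_add_log (N + 1)
    simpa [harmonic] using this
  have hH' : ∑ k ∈ Finset.range N, 1 / ((k : ℝ) + 1) ≤ 1 + Real.log (N + 1) := by
    refine le_trans ?_ hH
    rw [Finset.sum_range_succ]
    exact le_add_of_nonneg_right (by positivity)
  have hl : Real.log N ≤ Real.log (N + 1) := Real.log_le_log hN' (by linarith)
  have h1 : (∑ k ∈ Finset.range (N + 1), a k) / (N + 1) ≤ B * (1 + Real.log (N + 1)) / (N + 1) :=
    div_le_div_of_nonneg_right (h0.trans (mul_le_mul_of_nonneg_left hH hB)) (by positivity)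
  -- Each inner term is at most `1 / (j + 1)`; then `1 / ((j + 1) * (N - j))` splits into partial
  -- fractions, giving two harmonic sums.
  have h2 : ∑ j ∈ Finset.range N, B * (∑ k ∈ Finset.range (N + 1 - j), 1 / ((j : ℝ) + k + 1)) /
      (((N : ℝ) + 1 - j) * (N - j)) ≤
      ∑ j ∈ Finset.range N, B / (N + 1) * (1 / ((j : ℝ) + 1) + 1 / (N - j)) := by
    refine Finset.sum_le_sum fun j hj => ?_
    have hj1 : j < N := Finset.mem_range.1 hj
    have hj' : (j : ℝ) + 1 ≤ N := by exact_mod_cast hj1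
    have hm : (0 : ℝ) < N - j := by linarith
    have hm1 : (0 : ℝ) < N + 1 - j := by linarith
    have h3 : ∑ k ∈ Finset.range (N + 1 - j), 1 / ((j : ℝ) + k + 1) ≤
        ((N : ℝ) + 1 - j) * (1 / (j + 1)) := by
      refine (Finset.sum_le_sum (g := fun _ => 1 / ((j : ℝ) + 1)) fun k _ => ?_).trans ?_
      · exact one_div_le_one_div_of_le (by positivity) (by linarith [(k.cast_nonneg : (0 : ℝ) ≤ k)])
      · rw [Finset.sum_const, Finset.card_range, nsmul_eq_mul, Nat.cast_sub (by omega)]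
        push_cast; exact le_rfl
    calc _ ≤ B * (((N : ℝ) + 1 - j) * (1 / (j + 1))) / (((N : ℝ) + 1 - j) * (N - j)) :=
          div_le_div_of_nonneg_right (mul_le_mul_of_nonneg_left h3 hB) (by positivity)
      _ = _ := by field_simp; ring
  have h3 : ∑ j ∈ Finset.range N, B / (N + 1) * (1 / ((j : ℝ) + 1) + 1 / (N - j)) ≤
      B / (N + 1) * (2 * (1 + Real.log (N + 1))) := by
    rw [← Finset.mul_sum, Finset.sum_add_distrib]
    refine mul_le_mul_of_nonneg_left ?_ (by positivity)
    linarith [sum_inv_sub_le N hN]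
  calc _ ≤ B * (1 + Real.log (N + 1)) / (N + 1) + B / (N + 1) * (2 * (1 + Real.log (N + 1))) :=
        add_le_add h1 (h2.trans h3)
    _ = _ := by ring

end Sequences

/-! ### Expected progress of the iterates -/

section Expectation

lemma integral_bind_of_integrable {E F : Type*} [MeasurableSpace E] [MeasurableSpace F]
    {μ : Measure E} [IsFiniteMeasure μ] {κ : E → Measure F} (hκ : Measurable κ) {f : F → ℝ}
    (hf : Integrable f (μ.bind κ)) : ∫ y, f y ∂(μ.bind κ) = ∫ x, ∫ y, f y ∂(κ x) ∂μ := by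
  let K : Kernel E F := ⟨κ, hκ⟩
  have e : (K ∘ₖ Kernel.const Unit μ) () = μ.bind κ := by
    rw [Kernel.comp_apply, Kernel.const_apply]; rfl
  have h := Kernel.integral_comp (η := K) (κ := Kernel.const Unit μ) (a := ()) (f := f)
    (by rwa [e])
  rw [e, Kernel.const_apply] at h
  exact h

lemma stronglyMeasurable_integral_of_measurable {E F : Type*} [MeasurableSpace E]
    [MeasurableSpace F] {κ : E → Measure F} (hκ : Measurable κ) {f : F → ℝ}
    (hf : StronglyMeasurable f) : StronglyMeasurable fun x => ∫ y, f y ∂(κ x) :=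
  hf.integral_kernel (κ := (⟨κ, hκ⟩ : Kernel E F))

lemma integrable_of_bounded {E : Type*} [MeasurableSpace E] {μ : Measure E} [IsFiniteMeasure μ]
    {f : E → ℝ} (hf : StronglyMeasurable f) {M : ℝ} (hM : ∀ x, |f x| ≤ M) : Integrable f μ :=
  Integrable.of_bound hf.aestronglyMeasurable M (Filter.Eventually.of_forall hM)

lemma abs_integral_le_of_bounded {E : Type*} [MeasurableSpace E] {μ : Measure E}
    [IsProbabilityMeasure μ] {f : E → ℝ} {M : ℝ} (hM : ∀ x, |f x| ≤ M) : |∫ x, f x ∂μ| ≤ M := by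
  have := norm_integral_le_of_norm_le_const (μ := μ) (f := f) (C := M)
    (Filter.Eventually.of_forall hM)
  simpa using this

variable {X : Type*} {p n : ℕ} {C : Set (Param p)} {L : ℝ≥0}
  {loss : Param p → X → ℝ} {grad : Param p → X → Param p}

lemma integral_uniformOn_univ (f : Fin n → ℝ) :
    ∫ i, f i ∂(uniformOn (Set.univ : Set (Fin n))) = (∑ i, f i) / n := by
  rcases Nat.eq_zero_or_pos n with h0 | h0
  · subst h0
    rw [Subsingleton.elim f 0]
    simp
  have : NeZero n := ⟨h0.ne'⟩
  rw [integral_fintype (Integrable.of_finite), Finset.sum_div]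
  refine Finset.sum_congr rfl fun i _ => ?_
  rw [measureReal_def, uniformOn_univ, Measure.count_singleton]
  simp [div_eq_inv_mul]

/-- The noise is centered, so the cross term disappears and only its second moment `p * σsq`
remains. -/
lemma integral_norm_sub_smul_add_noise_sq {σsq : ℝ} (hσ : 0 ≤ σsq) (u g : Param p) (η : ℝ) :
    Integrable (fun b => ‖u - η • (g + b)‖ ^ 2) (noise p σsq) ∧
    ∫ b, ‖u - η • (g + b)‖ ^ 2 ∂(noise p σsq) = ‖u - η • g‖ ^ 2 + η ^ 2 * (p * σsq) := by
  have e : ∀ b : Param p, ‖u - η • (g + b)‖ ^ 2 =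
      ‖u - η • g‖ ^ 2 - 2 * η * inner ℝ (u - η • g) b + η ^ 2 * ‖b‖ ^ 2 := fun b => by
    rw [smul_add, ← sub_sub, norm_sub_sq_real, real_inner_smul_right, norm_smul, mul_pow,
      Real.norm_eq_abs, sq_abs]
    ring
  have i1 : Integrable (fun b : Param p => inner ℝ (u - η • g) b) (noise p σsq) :=
    (integrable_noise σsq).const_inner _
  have i2 := (integrable_norm_sq_noise (p := p) σsq).const_mul (η ^ 2)
  have i3 : Integrable (fun b : Param p => ‖u - η • g‖ ^ 2 - 2 * η * inner ℝ (u - η • g) b)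
      (noise p σsq) := (integrable_const (μ := noise p σsq) (‖u - η • g‖ ^ 2)).sub (i1.const_mul (2 * η))
  simp_rw [e]
  refine ⟨i3.add i2, ?_⟩
  have h0 : ∫ b : Param p, inner ℝ (u - η • g) b ∂(noise p σsq) = 0 := by
    rw [integral_inner (integrable_noise σsq), integral_noise, inner_zero_right]
  rw [integral_add i3 i2, integral_sub (integrable_const _) (i1.const_mul _), integral_const_mul,
    integral_const_mul, h0, integral_norm_sq_noise hσ]
  simp

/-- One step decreases the expected squared distance to any `z ∈ C`; `κ = 0` is the merely
convex case. -/
lemma integral_projStep_norm_sq_le [NeZero n] (h : IsLipschitzERM C L loss grad) {σsq : ℝ}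
    (hσ : 0 ≤ σsq) (D : Fin n → X) {η κ : ℝ} (hη : 0 ≤ η)
    (hκ : ∀ d, ∀ x ∈ C, ∀ y ∈ C,
      loss x d + inner ℝ (grad x d) (y - x) + κ / 2 * ‖y - x‖ ^ 2 ≤ loss y d)
    (θ : Param p) {z : Param p} (hz : z ∈ C) :
    ∫ y, ‖proj C y - z‖ ^ 2 ∂(projStep C grad σsq D η θ) ≤
      (1 - η * (n * κ)) * ‖proj C θ - z‖ ^ 2 -
        2 * η * (empiricalRisk loss D (proj C θ) - empiricalRisk loss D z) +
        η ^ 2 * (n ^ 2 * (L : ℝ) ^ 2 + p * σsq) := by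
  have hn : (0 : ℝ) < n := by exact_mod_cast Nat.pos_of_ne_zero (NeZero.ne n)
  have hpc := continuous_proj h.nonempty h.isClosed h.convex
  have hm : Measurable fun ib => stepMap C grad D η (θ, ib) :=
    (measurable_stepMap h D η).comp measurable_prodMk_left
  have hV : Continuous fun y => ‖proj C y - z‖ ^ 2 := by fun_prop
  set w := proj C θ with hw
  have hwC : w ∈ C := proj_mem h.nonempty h.isClosed θ
  have hbd : ∀ y, |‖proj C y - z‖ ^ 2| ≤ Metric.diam C ^ 2 := fun y => by
    rw [abs_of_nonneg (sq_nonneg _), ← dist_eq_norm]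
    exact pow_le_pow_left₀ dist_nonneg
      (Metric.dist_le_diam_of_mem h.isBounded (proj_mem h.nonempty h.isClosed y) hz) 2
  rw [projStep_eq_map, integral_map hm.aemeasurable hV.aestronglyMeasurable]
  have hint : Integrable (fun ib => ‖proj C (stepMap C grad D η (θ, ib)) - z‖ ^ 2)
      ((uniformOn (Set.univ : Set (Fin n))).prod (noise p σsq)) :=
    integrable_of_bounded (hV.measurable.comp hm).stronglyMeasurable fun ib => hbd _
  rw [integral_prod _ hint, integral_uniformOn_univ, div_le_iff₀ hn]
  have hi : ∀ i : Fin n, ∫ b, ‖proj C (stepMap C grad D η (θ, (i, b))) - z‖ ^ 2 ∂(noise p σsq) ≤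
      ‖w - z‖ ^ 2 - 2 * η * n * (loss w (D i) - loss z (D i) + κ / 2 * ‖w - z‖ ^ 2) +
        η ^ 2 * (n ^ 2 * (L : ℝ) ^ 2 + p * σsq) := fun i => by
    obtain ⟨hi1, hi2⟩ := integral_norm_sub_smul_add_noise_sq hσ (w - z)
      ((n : ℝ) • grad w (D i)) η
    have h1 : ∫ b, ‖proj C (stepMap C grad D η (θ, (i, b))) - z‖ ^ 2 ∂(noise p σsq) ≤
        -- Since `z ∈ C`, projecting does not increase the distance to `z`.
        ∫ b, ‖w - z - η • ((n : ℝ) • grad w (D i) + b)‖ ^ 2 ∂(noise p σsq) := by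
      refine integral_mono (integrable_of_bounded (M := Metric.diam C ^ 2)
        (hV.measurable.comp (hm.comp measurable_prodMk_left)).stronglyMeasurable
        fun b => hbd _) hi1 fun b => ?_
      refine pow_le_pow_left₀ (norm_nonneg _) ?_ 2
      have hmem : stepMap C grad D η (θ, (i, b)) ∈ C := proj_mem h.nonempty h.isClosed _
      rw [proj_eq_self h.isClosed hmem, stepMap]
      refine (norm_proj_sub_le h.isClosed h.convex _ hz).trans (le_of_eq ?_)
      congr 1
      simp only [← hw]
      abel
    refine h1.trans ?_
    rw [hi2, norm_sub_sq_real, real_inner_smul_right, real_inner_smul_right, norm_smul, norm_smul,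
      Real.norm_eq_abs, Real.norm_eq_abs, mul_pow, mul_pow, sq_abs, sq_abs]
    have hg := h.norm_grad_le_of_mem (D i) hwC
    have hg2 : ‖grad w (D i)‖ ^ 2 ≤ (L : ℝ) ^ 2 := pow_le_pow_left₀ (norm_nonneg _) hg 2
    have hk := hκ (D i) w hwC z hz
    have e1 : inner ℝ (grad w (D i)) (z - w) = - inner ℝ (w - z) (grad w (D i)) := by
      rw [real_inner_comm, ← inner_neg_left, neg_sub]
    rw [e1, norm_sub_rev z w] at hk
    have h2 := mul_le_mul_of_nonneg_left hg2 (show 0 ≤ η ^ 2 * (n : ℝ) ^ 2 by positivity)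
    have h3 := mul_le_mul_of_nonneg_left hk (show 0 ≤ 2 * η * n by positivity)
    linarith
  refine (Finset.sum_le_sum fun i _ => hi i).trans (le_of_eq ?_)
  rw [Finset.sum_add_distrib, Finset.sum_sub_distrib, ← Finset.mul_sum, Finset.sum_add_distrib,
    Finset.sum_sub_distrib]
  simp only [Finset.sum_const, Finset.card_univ, Fintype.card_fin, nsmul_eq_mul]
  unfold empiricalRisk
  ring

lemma continuousOn_empiricalRisk (h : IsLipschitzERM C L loss grad) (D : Fin n → X) :
    ContinuousOn (empiricalRisk loss D) C := by
  unfold empiricalRisk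
  exact continuousOn_finsetSum _ fun i _ => (h.lipschitzOn (D i)).continuousOn

lemma continuous_empiricalRisk_proj (h : IsLipschitzERM C L loss grad) (D : Fin n → X) :
    Continuous fun θ => empiricalRisk loss D (proj C θ) :=
  (continuousOn_empiricalRisk h D).comp_continuous
    (continuous_proj h.nonempty h.isClosed h.convex) fun θ => proj_mem h.nonempty h.isClosed θ

lemma exists_abs_empiricalRisk_proj_le (h : IsLipschitzERM C L loss grad) (D : Fin n → X) :
    ∃ M, ∀ θ, |empiricalRisk loss D (proj C θ)| ≤ M := by
  obtain ⟨M, hM⟩ := (Metric.isCompact_of_isClosed_isBounded h.isClosed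
    h.isBounded).exists_bound_of_continuousOn (continuousOn_empiricalRisk h D)
  exact ⟨M, fun θ => hM _ (proj_mem h.nonempty h.isClosed θ)⟩

/-- The expected risk after `k` updates. -/
def expectedRisk (C : Set (Param p)) (loss : Param p → X → ℝ) (grad : Param p → X → Param p)
    (σsq : ℝ) (η : ℕ → ℝ) (D : Fin n → X) (θ : Param p) (k : ℕ) : ℝ :=
  ∫ y, empiricalRisk loss D (proj C y) ∂(chainLaw C grad σsq η D θ k)

/-- The expected squared distance to `z` after `k` updates. -/
def expectedSqDist (C : Set (Param p)) (grad : Param p → X → Param p)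
    (σsq : ℝ) (η : ℕ → ℝ) (D : Fin n → X) (θ z : Param p) (k : ℕ) : ℝ :=
  ∫ y, ‖proj C y - z‖ ^ 2 ∂(chainLaw C grad σsq η D θ k)

lemma expectedSqDist_zero (h : IsLipschitzERM C L loss grad) (σsq : ℝ) (η : ℕ → ℝ)
    (D : Fin n → X) {θ : Param p} (hθ : θ ∈ C) (z : Param p) :
    expectedSqDist C grad σsq η D θ z 0 = ‖θ - z‖ ^ 2 := by
  rw [expectedSqDist, chainLaw, integral_dirac, proj_eq_self h.isClosed hθ]

lemma expectedSqDist_nonneg (σsq : ℝ) (η : ℕ → ℝ) (D : Fin n → X) (θ z : Param p) (k : ℕ) :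
    0 ≤ expectedSqDist C grad σsq η D θ z k :=
  integral_nonneg fun _ => sq_nonneg _

lemma norm_proj_sub_sq_le_diam (h : IsLipschitzERM C L loss grad) {z : Param p} (hz : z ∈ C)
    (y : Param p) : ‖proj C y - z‖ ^ 2 ≤ Metric.diam C ^ 2 := by
  rw [← dist_eq_norm]
  exact pow_le_pow_left₀ dist_nonneg
    (Metric.dist_le_diam_of_mem h.isBounded (proj_mem h.nonempty h.isClosed y) hz) 2

lemma expectedSqDist_le [NeZero n] (h : IsLipschitzERM C L loss grad) (σsq : ℝ) (η : ℕ → ℝ)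
    (D : Fin n → X) (θ : Param p) {z : Param p} (hz : z ∈ C) (k : ℕ) :
    expectedSqDist C grad σsq η D θ z k ≤ Metric.diam C ^ 2 := by
  have := isProbabilityMeasure_chainLaw h σsq η D θ k
  refine (le_abs_self _).trans (abs_integral_le_of_bounded fun y => ?_)
  rw [abs_of_nonneg (sq_nonneg _)]
  exact norm_proj_sub_sq_le_diam h hz y

lemma expectedSqDist_succ_le [NeZero n] (h : IsLipschitzERM C L loss grad) {σsq : ℝ}
    (hσ : 0 ≤ σsq) (D : Fin n → X) {η : ℕ → ℝ} {κ : ℝ} (hη : ∀ t, 0 ≤ η t)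
    (hκ : ∀ d, ∀ x ∈ C, ∀ y ∈ C,
      loss x d + inner ℝ (grad x d) (y - x) + κ / 2 * ‖y - x‖ ^ 2 ≤ loss y d)
    (θ : Param p) {z : Param p} (hz : z ∈ C) (k : ℕ) :
    expectedSqDist C grad σsq η D θ z (k + 1) ≤
      (1 - η (k + 1) * (n * κ)) * expectedSqDist C grad σsq η D θ z k -
        2 * η (k + 1) * (expectedRisk C loss grad σsq η D θ k - empiricalRisk loss D z) +
        η (k + 1) ^ 2 * (n ^ 2 * (L : ℝ) ^ 2 + p * σsq) := by
  have hP := isProbabilityMeasure_chainLaw h σsq η D θ k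
  have hP1 := isProbabilityMeasure_chainLaw h σsq η D θ (k + 1)
  have hK := measurable_projStep h σsq D (η (k + 1))
  have hKP := isProbabilityMeasure_projStep h σsq D (η (k + 1))
  have hpc := continuous_proj h.nonempty h.isClosed h.convex
  have hV : Continuous fun y => ‖proj C y - z‖ ^ 2 := by fun_prop
  have hVb : ∀ y, |‖proj C y - z‖ ^ 2| ≤ Metric.diam C ^ 2 := fun y => by
    rw [abs_of_nonneg (sq_nonneg _)]; exact norm_proj_sub_sq_le_diam h hz y
  obtain ⟨M, hM⟩ := exists_abs_empiricalRisk_proj_le h D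
  have iV : Integrable (fun y => ‖proj C y - z‖ ^ 2) (chainLaw C grad σsq η D θ k) :=
    integrable_of_bounded hV.stronglyMeasurable hVb
  have iR : Integrable (fun y => empiricalRisk loss D (proj C y))
      (chainLaw C grad σsq η D θ k) :=
    integrable_of_bounded (continuous_empiricalRisk_proj h D).stronglyMeasurable hM
  have iR' : Integrable (fun y => empiricalRisk loss D (proj C y) - empiricalRisk loss D z)
      (chainLaw C grad σsq η D θ k) := iR.sub (integrable_const (empiricalRisk loss D z))
  have i1 : Integrable (fun y => (1 - η (k + 1) * (n * κ)) * ‖proj C y - z‖ ^ 2 -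
      2 * η (k + 1) * (empiricalRisk loss D (proj C y) - empiricalRisk loss D z))
      (chainLaw C grad σsq η D θ k) := (iV.const_mul (1 - η (k + 1) * (n * κ))).sub (iR'.const_mul (2 * η (k + 1)))
  have i2 := i1.add (integrable_const (η (k + 1) ^ 2 * (n ^ 2 * (L : ℝ) ^ 2 + p * σsq)))
  have iK : Integrable (fun x => ∫ y, ‖proj C y - z‖ ^ 2 ∂(projStep C grad σsq D (η (k + 1)) x))
      (chainLaw C grad σsq η D θ k) :=
    integrable_of_bounded (stronglyMeasurable_integral_of_measurable hK hV.stronglyMeasurable)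
      fun x => abs_integral_le_of_bounded hVb
  have e1 : expectedSqDist C grad σsq η D θ z (k + 1) =
      ∫ x, ∫ y, ‖proj C y - z‖ ^ 2 ∂(projStep C grad σsq D (η (k + 1)) x)
        ∂(chainLaw C grad σsq η D θ k) :=
    integral_bind_of_integrable hK
      (integrable_of_bounded (μ := chainLaw C grad σsq η D θ (k + 1)) hV.stronglyMeasurable hVb)
  rw [e1]
  refine (integral_mono iK i2 fun x =>
    integral_projStep_norm_sq_le h hσ D (hη (k + 1)) hκ x hz).trans (le_of_eq ?_)
  rw [Pi.add_def, integral_add i1 (integrable_const _), integral_sub (iV.const_mul _) (iR'.const_mul _),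
    integral_const_mul, integral_const_mul, integral_sub iR (integrable_const _)]
  simp [expectedSqDist, expectedRisk]

/-- Bounds that hold from every starting point with the shifted learning rate carry over to the
tail of a run, with the iterate at the start of the tail as the comparator. -/
lemma sum_expectedRisk_sub_le [NeZero n] (h : IsLipschitzERM C L loss grad) {σsq : ℝ}
    (D : Fin n → X) {η : ℕ → ℝ} {θ : Param p} (hθ : θ ∈ C) {j m : ℕ} {β : ℝ}
    (hβ : ∀ w ∈ C, ∑ k ∈ Finset.range m, (expectedRisk C loss grad σsq (fun i => η (j + i)) D w k -
      empiricalRisk loss D w) ≤ β) :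
    ∑ k ∈ Finset.range m, (expectedRisk C loss grad σsq η D θ (j + k) -
      expectedRisk C loss grad σsq η D θ j) ≤ β := by
  have hP := isProbabilityMeasure_chainLaw h σsq η D θ j
  obtain ⟨M, hM⟩ := exists_abs_empiricalRisk_proj_le h D
  have hsm := (continuous_empiricalRisk_proj h D).stronglyMeasurable
  have iR : Integrable (fun y => empiricalRisk loss D (proj C y))
      (chainLaw C grad σsq η D θ j) := integrable_of_bounded hsm hM
  have iE : ∀ k, Integrable (fun w => expectedRisk C loss grad σsq (fun i => η (j + i)) D w k)
      (chainLaw C grad σsq η D θ j) := fun k => by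
    have := fun w => isProbabilityMeasure_chainLaw h σsq (fun i => η (j + i)) D w k
    exact integrable_of_bounded (stronglyMeasurable_integral_of_measurable
      (measurable_chainLaw h σsq (fun i => η (j + i)) D k) hsm)
      fun w => abs_integral_le_of_bounded hM
  have e : ∀ k, expectedRisk C loss grad σsq η D θ (j + k) - expectedRisk C loss grad σsq η D θ j =
      ∫ w, (expectedRisk C loss grad σsq (fun i => η (j + i)) D w k -
        empiricalRisk loss D (proj C w)) ∂(chainLaw C grad σsq η D θ j) := fun k => by
    have := isProbabilityMeasure_chainLaw h σsq η D θ (j + k)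
    rw [integral_sub (iE k) iR]
    congr 1
    have hi : Integrable (fun y => empiricalRisk loss D (proj C y))
      (chainLaw C grad σsq η D θ (j + k)) := integrable_of_bounded hsm hM
    rw [chainLaw_add h] at hi
    rw [expectedRisk, chainLaw_add h]
    exact integral_bind_of_integrable (measurable_chainLaw h σsq _ D k) hi
  have iD : ∀ k, Integrable (fun w => expectedRisk C loss grad σsq (fun i => η (j + i)) D w k -
      empiricalRisk loss D (proj C w)) (chainLaw C grad σsq η D θ j) := fun k => (iE k).sub iR
  simp_rw [e]
  rw [← integral_finsetSum _ fun k _ => iD k]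
  have : ∫ _ : Param p, β ∂(chainLaw C grad σsq η D θ j) = β := by simp
  rw [← this]
  refine integral_mono_ae (integrable_finsetSum _ fun k _ => iD k)
    (integrable_const _) ?_
  filter_upwards [ae_mem_chainLaw h σsq η D hθ j] with w hw
  rw [proj_eq_self h.isClosed hw]
  exact hβ w hw

end Expectation

/-! ### Utility -/

section Utility

variable {X : Type*} {p n : ℕ} {C : Set (Param p)} {L : ℝ≥0}
  {loss : Param p → X → ℝ} {grad : Param p → X → Param p}

/-- The risk is controlled only on `C`; composed with the projection it is bounded and continuous
everywhere, and the two agree almost surely because the output lies in `C`. -/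
lemma integrable_and_integral_outputLaw [NeZero n] (h : IsLipschitzERM C L loss grad) (σsq : ℝ)
    (η : ℕ → ℝ) (D : Fin n → X) {θ₁ : Param p} (hθ₁ : θ₁ ∈ C) (c : ℝ) :
    Integrable (fun θ => empiricalRisk loss D θ - c) (outputLaw C grad σsq η θ₁ D) ∧
    ∫ θ, (empiricalRisk loss D θ - c) ∂(outputLaw C grad σsq η θ₁ D) =
      expectedRisk C loss grad σsq η D θ₁ (n ^ 2 - 1) - c := by
  rw [outputLaw, iterateLaw_eq_chainLaw h σsq η D hθ₁]
  have := isProbabilityMeasure_chainLaw h σsq η D θ₁ (n ^ 2 - 1)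
  obtain ⟨M, hM⟩ := exists_abs_empiricalRisk_proj_le h D
  have hi : Integrable (fun θ => empiricalRisk loss D (proj C θ))
      (chainLaw C grad σsq η D θ₁ (n ^ 2 - 1)) :=
    integrable_of_bounded (continuous_empiricalRisk_proj h D).stronglyMeasurable hM
  have he : (fun θ => empiricalRisk loss D (proj C θ) - c) =ᵐ[chainLaw C grad σsq η D θ₁
      (n ^ 2 - 1)] fun θ => empiricalRisk loss D θ - c := by
    filter_upwards [ae_mem_chainLaw h σsq η D hθ₁ (n ^ 2 - 1)] with θ hθ
    rw [proj_eq_self h.isClosed hθ]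
  refine ⟨(integrable_congr he).1 (hi.sub (integrable_const c)), ?_⟩
  rw [← integral_congr_ae he, integral_sub hi (integrable_const c), expectedRisk]
  simp

lemma expectedRisk_eq_of_forall_eq [NeZero n] (h : IsLipschitzERM C L loss grad) (σsq : ℝ)
    (η : ℕ → ℝ) (D : Fin n → X) (θ₁ : Param p) {c : ℝ}
    (hc : ∀ y ∈ C, empiricalRisk loss D y = c) (k : ℕ) :
    expectedRisk C loss grad σsq η D θ₁ k = c := by
  have := isProbabilityMeasure_chainLaw h σsq η D θ₁ k
  rw [expectedRisk]
  simp [hc _ (proj_mem h.nonempty h.isClosed _)]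

lemma natCast_sq_sub_one_add_one [NeZero n] : n ^ 2 - 1 + 1 = n ^ 2 :=
  Nat.sub_add_cancel (Nat.one_le_pow _ _ (Nat.pos_of_ne_zero (NeZero.ne n)))

/-- The last-iterate guarantee of projected stochastic gradient descent, convex case. -/
lemma expectedRisk_lipschitzRate_le [NeZero n] (h : IsLipschitzERM C L loss grad) (hn : 2 ≤ n)
    {σsq : ℝ} (hσ : 0 ≤ σsq) (D : Fin n → X) {θ₁ θs : Param p} (hθ₁ : θ₁ ∈ C) (hθs : θs ∈ C)
    (hR : 0 < Metric.diam C) (hG : 0 < (n : ℝ) ^ 2 * (L : ℝ) ^ 2 + p * σsq) :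
    expectedRisk C loss grad σsq (lipschitzRate C L n σsq) D θ₁ (n ^ 2 - 1) -
      empiricalRisk loss D θs ≤ 3 / 2 * Metric.diam C *
        Real.sqrt ((n : ℝ) ^ 2 * (L : ℝ) ^ 2 + p * σsq) * (2 + 2 * Real.log n) / n := by
  set R := Metric.diam C with hRdef
  set G := Real.sqrt ((n : ℝ) ^ 2 * (L : ℝ) ^ 2 + p * σsq) with hGdef
  have hG0 : 0 < G := Real.sqrt_pos.2 hG
  have hG2 : G ^ 2 = (n : ℝ) ^ 2 * (L : ℝ) ^ 2 + p * σsq := Real.sq_sqrt hG.le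
  have hc : 0 < R / G := div_pos hR hG0
  have hrate : ∀ t : ℕ, lipschitzRate C L n σsq t = R / G / Real.sqrt t := fun t => by
    rw [lipschitzRate, Real.sqrt_mul (Nat.cast_nonneg t), ← hGdef, ← hRdef]
    field_simp
  have hη : ∀ t, 0 ≤ lipschitzRate C L n σsq t := fun t => by
    rw [hrate]; positivity
  have hκ : ∀ d, ∀ x ∈ C, ∀ y ∈ C,
      loss x d + inner ℝ (grad x d) (y - x) + 0 / 2 * ‖y - x‖ ^ 2 ≤ loss y d :=
    fun d x hx y hy => by simpa using h.isSubgradient d x hx y hy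
  have main : ∀ (j m : ℕ) (w z : Param p), w ∈ C → z ∈ C → Real.sqrt j * ‖w - z‖ ^ 2 = 0 →
      ∑ k ∈ Finset.range m, (expectedRisk C loss grad σsq
        (fun i => lipschitzRate C L n σsq (j + i)) D w k - empiricalRisk loss D z) ≤
      3 / 2 * R * G * (Real.sqrt ((j + m : ℕ)) - Real.sqrt j) := by
    intro j m w z hw hz hj
    have := sum_le_of_sqrt_rate (c := R / G) (G := G) (R := R)
      (e := expectedSqDist C grad σsq (fun i => lipschitzRate C L n σsq (j + i)) D w z)
      (g := fun k => expectedRisk C loss grad σsq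
        (fun i => lipschitzRate C L n σsq (j + i)) D w k - empiricalRisk loss D z) hc j
      (fun k => expectedSqDist_le h σsq _ D w hz k)
      (by rw [expectedSqDist_zero h σsq _ D hw]; exact hj)
      (fun k => expectedSqDist_nonneg _ _ _ _ _ _) (fun k => ?_) m
    -- With `c = R / G` the two error terms become multiples of `R ^ 2`, together `3 * R ^ 2`.
    · have e1 : R ^ 2 + 2 * (R / G) ^ 2 * G ^ 2 = 2 * (R / G) * (3 / 2 * R * G) := by
        field_simp; ring
      rw [e1, mul_assoc (2 * (R / G))] at this
      exact le_of_mul_le_mul_left this (by positivity)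
    · have := expectedSqDist_succ_le h hσ D (η := fun i => lipschitzRate C L n σsq (j + i))
        (fun t => hη _) hκ w hz k
      simp only [mul_zero, sub_zero, one_mul] at this
      rw [hrate, ← hG2, ← add_assoc] at this
      exact this
  have hN : n ^ 2 - 1 + 1 = n ^ 2 := natCast_sq_sub_one_add_one
  have hn0 : (0 : ℝ) < n := by exact_mod_cast (by omega : 0 < n)
  have hsq : Real.sqrt ((n ^ 2 - 1 + 1 : ℕ)) = n := by
    rw [hN]; push_cast; exact Real.sqrt_sq hn0.le
  have hN1 : 1 ≤ n ^ 2 - 1 := by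
    have : 2 ^ 2 ≤ n ^ 2 := Nat.pow_le_pow_left hn 2
    omega
  have hB : 0 ≤ 3 / 2 * R * G := by positivity
  have last := last_le_of_sqrt_rate (N := n ^ 2 - 1) (B := 3 / 2 * R * G)
    (a := fun k => expectedRisk C loss grad σsq (lipschitzRate C L n σsq) D θ₁ k -
      empiricalRisk loss D θs) hB hN1 ?_ ?_
  · rw [hsq] at last
    refine last.trans (div_le_div_of_nonneg_right (mul_le_mul_of_nonneg_left ?_ hB) hn0.le)
    have : Real.log ((n ^ 2 - 1 : ℕ)) ≤ Real.log ((n : ℝ) ^ 2) :=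
      Real.log_le_log (by exact_mod_cast hN1) (by exact_mod_cast Nat.sub_le _ _)
    rw [Real.log_pow] at this
    push_cast at this ⊢
    linarith
  · have := main 0 (n ^ 2 - 1 + 1) θ₁ θs hθ₁ hθs (by simp)
    simp only [zero_add, Nat.cast_zero, Real.sqrt_zero, sub_zero] at this
    exact this
  · intro j hj
    have e : j + (n ^ 2 - 1 + 1 - j) = n ^ 2 - 1 + 1 := by omega
    have := sum_expectedRisk_sub_le h (σsq := σsq) D (η := lipschitzRate C L n σsq) hθ₁
      (j := j) (m := n ^ 2 - 1 + 1 - j) fun w hw => main j _ w w hw hw (by simp)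
    rw [e] at this
    simpa using this

/-- The last-iterate guarantee of projected stochastic gradient descent, strongly convex case. -/
lemma expectedRisk_stronglyConvexRate_le [NeZero n] (h : IsLipschitzERM C L loss grad)
    (hn : 2 ≤ n) {σsq Δ : ℝ} (hσ : 0 ≤ σsq) (hΔ : 0 < Δ)
    (hsc : ∀ d, IsStronglyConvex C Δ fun θ => loss θ d) (D : Fin n → X) {θ₁ θs : Param p}
    (hθ₁ : θ₁ ∈ C) (hθs : θs ∈ C) :
    expectedRisk C loss grad σsq (stronglyConvexRate Δ n) D θ₁ (n ^ 2 - 1) -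
      empiricalRisk loss D θs ≤ 3 * (((n : ℝ) ^ 2 * (L : ℝ) ^ 2 + p * σsq) / (2 * (n * Δ))) *
        (1 + 2 * Real.log n) / n ^ 2 := by
  have hn0 : (0 : ℝ) < n := by exact_mod_cast (by omega : 0 < n)
  set G := (n : ℝ) ^ 2 * (L : ℝ) ^ 2 + p * σsq with hGdef
  have hG0 : 0 ≤ G := by positivity
  have hμ : 0 < n * Δ := by positivity
  have hrate : ∀ t : ℕ, stronglyConvexRate Δ n t = 1 / (n * Δ * t) := fun t => by
    rw [stronglyConvexRate, mul_comm Δ]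
  have hη : ∀ t, 0 ≤ stronglyConvexRate Δ n t := fun t => by
    rw [hrate]; positivity
  have hκ : ∀ d, ∀ x ∈ C, ∀ y ∈ C,
      loss x d + inner ℝ (grad x d) (y - x) + Δ / 2 * ‖y - x‖ ^ 2 ≤ loss y d :=
    fun d x hx y hy => hsc d x hx _ (h.isSubgradient d x hx) y hy
  have main : ∀ (j m : ℕ) (w z : Param p), w ∈ C → z ∈ C → (j : ℝ) * ‖w - z‖ ^ 2 = 0 →
      ∑ k ∈ Finset.range m, (expectedRisk C loss grad σsq
        (fun i => stronglyConvexRate Δ n (j + i)) D w k - empiricalRisk loss D z) ≤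
      G / (2 * (n * Δ)) * ∑ k ∈ Finset.range m, 1 / ((j : ℝ) + k + 1) := by
    intro j m w z hw hz hj
    refine sum_le_of_inv_rate
      (e := expectedSqDist C grad σsq (fun i => stronglyConvexRate Δ n (j + i)) D w z)
      hμ j (by rw [expectedSqDist_zero h σsq _ D hw]; exact hj)
      (fun k => expectedSqDist_nonneg _ _ _ _ _ _) (fun k => ?_) m
    have := expectedSqDist_succ_le h hσ D (η := fun i => stronglyConvexRate Δ n (j + i))
      (fun t => hη _) hκ w hz k
    rw [hrate, ← add_assoc] at this
    exact this
  have hN : n ^ 2 - 1 + 1 = n ^ 2 := natCast_sq_sub_one_add_one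
  have hN1 : 1 ≤ n ^ 2 - 1 := by
    have : 2 ^ 2 ≤ n ^ 2 := Nat.pow_le_pow_left hn 2
    omega
  have hcast : ((n ^ 2 - 1 : ℕ) : ℝ) + 1 = (n : ℝ) ^ 2 := by exact_mod_cast hN
  have last := last_le_of_inv_rate (N := n ^ 2 - 1) (B := G / (2 * (n * Δ)))
    (a := fun k => expectedRisk C loss grad σsq (stronglyConvexRate Δ n) D θ₁ k -
      empiricalRisk loss D θs) (by positivity) hN1 ?_ ?_
  · rw [hcast, Real.log_pow] at last
    exact_mod_cast last
  · have := main 0 (n ^ 2 - 1 + 1) θ₁ θs hθ₁ hθs (by simp)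
    simp only [zero_add, Nat.cast_zero] at this
    exact this
  · intro j hj
    have := sum_expectedRisk_sub_le h (σsq := σsq) D (η := stronglyConvexRate Δ n) hθ₁
      (j := j) (m := n ^ 2 - 1 + 1 - j) fun w hw => main j _ w w hw hw (by simp)
    simpa using this

lemma AdmissiblePrivacy.log_inv_pos {ε δ : ℝ} (h : AdmissiblePrivacy ε δ) :
    0 < Real.log (1 / δ) :=
  Real.log_pos (by rw [lt_div_iff₀ h.1]; linarith [h.2.1])

lemma AdmissiblePrivacy.log_le_log_div {ε δ : ℝ} (h : AdmissiblePrivacy ε δ) (hn : 2 ≤ n) :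
    Real.log n ≤ Real.log (n / δ) :=
  Real.log_le_log (by exact_mod_cast (by omega : 0 < n))
    ((le_div_iff₀ h.1).2 (mul_le_of_le_one_right (Nat.cast_nonneg n) h.2.1.le))

lemma AdmissiblePrivacy.two_le_three_mul_log {ε δ : ℝ} (h : AdmissiblePrivacy ε δ) (hn : 2 ≤ n) :
    2 ≤ 3 * Real.log (n / δ) := by
  have h1 := h.log_le_log_div hn
  have h2 : Real.log 2 ≤ Real.log n := Real.log_le_log (by norm_num) (by exact_mod_cast hn)
  linarith [Real.log_two_gt_d9]

/-- The second moment of the stochastic gradients, in terms of the variance scale. -/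
lemma second_moment_le {ε δ σsq K : ℝ} (h : AdmissiblePrivacy ε δ) (hn : 2 ≤ n) (hp : 1 ≤ p)
    (hσK : σsq ≤ K * varianceScale L n ε δ) :
    (n : ℝ) ^ 2 * (L : ℝ) ^ 2 + p * σsq ≤ (6 + |K|) *
      ((n : ℝ) ^ 2 * (L : ℝ) ^ 2 * (p * (Real.log (n / δ) * Real.log (1 / δ) / ε ^ 2))) := by
  have hx := h.log_inv_pos
  have hΛ := h.two_le_three_mul_log hn
  obtain ⟨hδ0, hδ1, hε0, hε⟩ := h
  set x := Real.log (1 / δ)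
  set Λ := Real.log (n / δ)
  have hΛ0 : 0 < Λ := by linarith
  have hp' : (1 : ℝ) ≤ p := by exact_mod_cast hp
  have hε2 : ε ^ 2 ≤ 4 * x := by
    have := pow_le_pow_left₀ hε0.le hε 2
    rw [mul_pow, Real.sq_sqrt hx.le] at this
    linarith
  set r := Λ * x / ε ^ 2 with hr
  have hr0 : 0 < r := by positivity
  -- `Λ ≥ 2 / 3` and `ε ^ 2 ≤ 4 * x` give `r ≥ 1 / 6`; the noise-free part of the second moment is
  -- thereby absorbed, which also needs `p ≥ 1`.
  have hr6 : 1 ≤ 6 * r := by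
    rw [hr, ← mul_div_assoc, one_le_div (by positivity)]
    nlinarith
  have hscale : varianceScale L n ε δ = (n : ℝ) ^ 2 * (L : ℝ) ^ 2 * r := by
    change (L : ℝ) ^ 2 * n ^ 2 * Λ * x / ε ^ 2 = _
    rw [hr]; ring
  rw [hscale] at hσK
  have hs0 : 0 ≤ (n : ℝ) ^ 2 * (L : ℝ) ^ 2 := by positivity
  have h1 : (n : ℝ) ^ 2 * (L : ℝ) ^ 2 ≤ 6 * ((n : ℝ) ^ 2 * (L : ℝ) ^ 2 * (p * r)) := by
    have h2 : 1 ≤ 6 * (p * r) := by nlinarith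
    nlinarith
  have h3 : p * σsq ≤ |K| * ((n : ℝ) ^ 2 * (L : ℝ) ^ 2 * (p * r)) := by
    have h4 : σsq ≤ |K| * ((n : ℝ) ^ 2 * (L : ℝ) ^ 2 * r) :=
      hσK.trans (mul_le_mul_of_nonneg_right (le_abs_self K) (by positivity))
    have h5 := mul_le_mul_of_nonneg_left h4 (show (0 : ℝ) ≤ p by linarith)
    linarith
  linarith

lemma eq_of_diam_eq_zero (h : IsLipschitzERM C L loss grad) (hR : Metric.diam C = 0)
    {x y : Param p} (hx : x ∈ C) (hy : y ∈ C) : x = y :=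
  dist_le_zero.1 ((Metric.dist_le_diam_of_mem h.isBounded hx hy).trans hR.le)

lemma empiricalRisk_eq_of_lipschitz_zero (h : IsLipschitzERM C L loss grad) (hL : L = 0)
    (D : Fin n → X) {x y : Param p} (hx : x ∈ C) (hy : y ∈ C) :
    empiricalRisk loss D x = empiricalRisk loss D y := by
  refine Finset.sum_congr rfl fun i _ => ?_
  have := (h.lipschitzOn (D i)).dist_le_mul x hx y hy
  rw [hL] at this
  exact dist_le_zero.1 (by simpa using this)

theorem expectedRisk_lipschitzRate_le_of_variance [NeZero n] (h : IsLipschitzERM C L loss grad)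
    (hn : 2 ≤ n) {ε δ σsq K : ℝ} (hεδ : AdmissiblePrivacy ε δ) (hσ : 0 ≤ σsq)
    (hσK : σsq ≤ K * varianceScale L n ε δ) (D : Fin n → X) {θ₁ θs : Param p}
    (hθ₁ : θ₁ ∈ C) (hθs : θs ∈ C) :
    expectedRisk C loss grad σsq (lipschitzRate C L n σsq) D θ₁ (n ^ 2 - 1) -
      empiricalRisk loss D θs ≤ 8 * (6 + |K|) * (L * Metric.diam C *
        Real.log (n / δ) ^ (3 / 2 : ℝ) * Real.sqrt (p * Real.log (1 / δ)) / ε) := by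
  have hx := hεδ.log_inv_pos
  have hΛ := hεδ.two_le_three_mul_log hn
  have hlog := hεδ.log_le_log_div hn
  have hε0 := hεδ.2.2.1
  have hΛ0 : 0 < Real.log (n / δ) := by linarith
  have hn0 : (0 : ℝ) < n := by exact_mod_cast (by omega : 0 < n)
  have hRHS : 0 ≤ 8 * (6 + |K|) * (L * Metric.diam C *
      Real.log (n / δ) ^ (3 / 2 : ℝ) * Real.sqrt (p * Real.log (1 / δ)) / ε) := by
    have := Metric.diam_nonneg (s := C)
    have := abs_nonneg K
    positivity
  -- A constant risk has no excess. This disposes of `p = 0`, a one-point `C` and `L = 0`, hence of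
  -- every case with a vanishing rate or denominator.
  by_cases hconst : ∀ y ∈ C, empiricalRisk loss D y = empiricalRisk loss D θs
  · rw [expectedRisk_eq_of_forall_eq h σsq _ D θ₁ hconst, sub_self]
    exact hRHS
  have hp : 1 ≤ p := by
    by_contra! hp0
    obtain rfl : p = 0 := by omega
    exact hconst fun y _ => by rw [Subsingleton.elim y θs]
  have hR : 0 < Metric.diam C := lt_of_le_of_ne Metric.diam_nonneg fun hR =>
    hconst fun y hy => by rw [eq_of_diam_eq_zero h hR.symm hy hθs]
  have hL : (0 : ℝ) < L := by
    have : L ≠ 0 := fun hL => hconst fun y hy => empiricalRisk_eq_of_lipschitz_zero h hL D hy hθs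
    exact_mod_cast pos_iff_ne_zero.2 this
  have hG : 0 < (n : ℝ) ^ 2 * (L : ℝ) ^ 2 + p * σsq := by positivity
  refine (expectedRisk_lipschitzRate_le h hn hσ D hθ₁ hθs hR hG).trans ?_
  have hK1 : 1 ≤ 6 + |K| := by linarith [abs_nonneg K]
  have hsqrt : Real.sqrt ((n : ℝ) ^ 2 * (L : ℝ) ^ 2 + p * σsq) ≤ (6 + |K|) *
      (n * L * (Real.sqrt (Real.log (n / δ)) * Real.sqrt (p * Real.log (1 / δ)) / ε)) := by
    refine Real.sqrt_le_iff.2 ⟨by positivity, (second_moment_le hεδ hn hp hσK).trans ?_⟩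
    rw [mul_pow, mul_pow, mul_pow, div_pow, mul_pow, Real.sq_sqrt hΛ0.le, Real.sq_sqrt (by positivity)]
    have e : (6 + |K|) ≤ (6 + |K|) ^ 2 := by nlinarith
    calc _ ≤ (6 + |K|) ^ 2 * ((n : ℝ) ^ 2 * (L : ℝ) ^ 2 *
          (p * (Real.log (n / δ) * Real.log (1 / δ) / ε ^ 2))) :=
        mul_le_mul_of_nonneg_right e (by positivity)
      _ = _ := by ring
  have hpow : Real.log (n / δ) ^ (3 / 2 : ℝ) = Real.log (n / δ) * Real.sqrt (Real.log (n / δ)) := by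
    rw [Real.sqrt_eq_rpow, ← Real.rpow_one_add' hΛ0.le (by norm_num)]
    norm_num
  -- The `2` is at most `3 * log (n / δ)` since `n ≥ 2`. The resulting constant is `3 / 2 * 5 = 15 /
  -- 2 ≤ 8`.
  have hl : 2 + 2 * Real.log n ≤ 5 * Real.log (n / δ) := by linarith
  have hl0 : 0 ≤ 2 + 2 * Real.log n := by
    have := Real.log_natCast_nonneg n
    linarith
  calc 3 / 2 * Metric.diam C * Real.sqrt ((n : ℝ) ^ 2 * (L : ℝ) ^ 2 + p * σsq) *
        (2 + 2 * Real.log n) / n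
      ≤ 3 / 2 * Metric.diam C * ((6 + |K|) *
        (n * L * (Real.sqrt (Real.log (n / δ)) * Real.sqrt (p * Real.log (1 / δ)) / ε))) *
        (5 * Real.log (n / δ)) / n := by gcongr
    _ = 15 / 2 * (6 + |K|) * (L * Metric.diam C *
        Real.log (n / δ) ^ (3 / 2 : ℝ) * Real.sqrt (p * Real.log (1 / δ)) / ε) := by
      rw [hpow]; field_simp; ring
    _ ≤ _ := by
      have h0 : 0 ≤ (6 + |K|) * (L * Metric.diam C *
        Real.log (n / δ) ^ (3 / 2 : ℝ) * Real.sqrt (p * Real.log (1 / δ)) / ε) := by positivity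
      linarith

theorem expectedRisk_stronglyConvexRate_le_of_variance [NeZero n]
    (h : IsLipschitzERM C L loss grad) (hn : 2 ≤ n) {ε δ σsq K Δ : ℝ}
    (hεδ : AdmissiblePrivacy ε δ) (hσ : 0 ≤ σsq) (hσK : σsq ≤ K * varianceScale L n ε δ)
    (hΔ : 0 < Δ) (hsc : ∀ d, IsStronglyConvex C Δ fun θ => loss θ d) (D : Fin n → X)
    {θ₁ θs : Param p} (hθ₁ : θ₁ ∈ C) (hθs : θs ∈ C) :
    expectedRisk C loss grad σsq (stronglyConvexRate Δ n) D θ₁ (n ^ 2 - 1) -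
      empiricalRisk loss D θs ≤ 8 * (6 + |K|) * ((L : ℝ) ^ 2 * Real.log (n / δ) ^ 2 * p *
        Real.log (1 / δ) / (n * Δ * ε ^ 2)) := by
  have hx := hεδ.log_inv_pos
  have hΛ := hεδ.two_le_three_mul_log hn
  have hlog := hεδ.log_le_log_div hn
  have hε0 := hεδ.2.2.1
  have hΛ0 : 0 < Real.log (n / δ) := by linarith
  have hn0 : (0 : ℝ) < n := by exact_mod_cast (by omega : 0 < n)
  have hK1 := abs_nonneg K
  rcases Nat.eq_zero_or_pos p with rfl | hp
  · rw [expectedRisk_eq_of_forall_eq h σsq _ D θ₁ (c := empiricalRisk loss D θs)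
      fun y _ => by rw [Subsingleton.elim y θs]]
    simp
  refine (expectedRisk_stronglyConvexRate_le h hn hσ hΔ hsc D hθ₁ hθs).trans ?_
  have hl : 1 + 2 * Real.log n ≤ 4 * Real.log (n / δ) := by linarith
  have hl0 : 0 ≤ 1 + 2 * Real.log n := by
    have := Real.log_natCast_nonneg n
    linarith
  have hG := second_moment_le hεδ hn hp hσK
  calc 3 * (((n : ℝ) ^ 2 * (L : ℝ) ^ 2 + p * σsq) / (2 * (n * Δ))) *
        (1 + 2 * Real.log n) / n ^ 2
      ≤ 3 * (((6 + |K|) * ((n : ℝ) ^ 2 * (L : ℝ) ^ 2 * (p * (Real.log (n / δ) *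
        Real.log (1 / δ) / ε ^ 2)))) / (2 * (n * Δ))) * (4 * Real.log (n / δ)) / n ^ 2 := by
        gcongr
    _ = 6 * (6 + |K|) * ((L : ℝ) ^ 2 * Real.log (n / δ) ^ 2 * p *
        Real.log (1 / δ) / (n * Δ * ε ^ 2)) := by field_simp; ring
    _ ≤ _ := by
      have h0 : 0 ≤ (6 + |K|) * ((L : ℝ) ^ 2 * Real.log (n / δ) ^ 2 * p *
        Real.log (1 / δ) / (n * Δ * ε ^ 2)) := by positivity
      linarith

end Utility

end NoisyGD

end

theorem mainTheorem1 :
    -- Privacy: variance `32 L² n² log(n/δ) log(1/δ) / ε²`, any learning rate, any initial point.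
    (∀ (X : Type*) (p n : ℕ) (C : Set (NoisyGD.Param p)) (L : ℝ≥0)
      (loss : NoisyGD.Param p → X → ℝ) (grad : NoisyGD.Param p → X → NoisyGD.Param p)
      (ε δ : ℝ) (η : ℕ → ℝ) (θ₁ : NoisyGD.Param p),
      NoisyGD.IsLipschitzERM C L loss grad → NoisyGD.AdmissiblePrivacy ε δ → θ₁ ∈ C →
      NoisyGD.IsDifferentiallyPrivate
        (fun D : Fin n → X =>
          NoisyGD.outputLaw C grad (32 * NoisyGD.varianceScale L n ε δ) η θ₁ D) ε δ) ∧
    -- Utility: for each `K` the bounds hold with one constant `c` for every `σ² ≤ K · scale`.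
    (∀ K : ℝ, ∃ c : ℝ, 0 < c ∧
      ∀ (X : Type*) (p n : ℕ) (C : Set (NoisyGD.Param p)) (L : ℝ≥0)
        (loss : NoisyGD.Param p → X → ℝ) (grad : NoisyGD.Param p → X → NoisyGD.Param p)
        (ε δ σsq : ℝ) (θ₁ : NoisyGD.Param p) (D : Fin n → X) (θs : NoisyGD.Param p),
        2 ≤ n → NoisyGD.IsLipschitzERM C L loss grad → NoisyGD.AdmissiblePrivacy ε δ →
        0 ≤ σsq → σsq ≤ K * NoisyGD.varianceScale L n ε δ → θ₁ ∈ C →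
        θs ∈ C → IsMinOn (NoisyGD.empiricalRisk loss D) C θs →
        -- Lipschitz convex losses
        (Integrable
            (fun θ => NoisyGD.empiricalRisk loss D θ - NoisyGD.empiricalRisk loss D θs)
            (NoisyGD.outputLaw C grad σsq (NoisyGD.lipschitzRate C L n σsq) θ₁ D) ∧
          ∫ θ, (NoisyGD.empiricalRisk loss D θ - NoisyGD.empiricalRisk loss D θs)
            ∂(NoisyGD.outputLaw C grad σsq (NoisyGD.lipschitzRate C L n σsq) θ₁ D) ≤
          c * (L * Metric.diam C * Real.log (n / δ) ^ (3 / 2 : ℝ) *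
            Real.sqrt (p * Real.log (1 / δ)) / ε)) ∧
        -- Lipschitz and strongly convex losses
        (∀ Δ : ℝ, 0 < Δ →
          (∀ d, NoisyGD.IsStronglyConvex C Δ fun θ => loss θ d) →
          Integrable
            (fun θ => NoisyGD.empiricalRisk loss D θ - NoisyGD.empiricalRisk loss D θs)
            (NoisyGD.outputLaw C grad σsq (NoisyGD.stronglyConvexRate Δ n) θ₁ D) ∧
          ∫ θ, (NoisyGD.empiricalRisk loss D θ - NoisyGD.empiricalRisk loss D θs)
            ∂(NoisyGD.outputLaw C grad σsq (NoisyGD.stronglyConvexRate Δ n) θ₁ D) ≤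
          c * ((L : ℝ) ^ 2 * Real.log (n / δ) ^ 2 * p * Real.log (1 / δ) /
            (n * Δ * ε ^ 2)))) := by
  -- The constant `8 * (6 + |K|)` serves both rates: the computations give `15 / 2` and `6` in place
  -- of `8`.
  refine ⟨fun X p n C L loss grad ε δ η θ₁ h hεδ hθ₁ =>
    NoisyGD.isDifferentiallyPrivate_outputLaw h hεδ η hθ₁, fun K => ⟨8 * (6 + |K|), by positivity,
    fun X p n C L loss grad ε δ σsq θ₁ D θs hn h hεδ hσ hσK hθ₁ hθs _ => ?_⟩⟩
  have : NeZero n := ⟨by omega⟩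
  refine ⟨?_, fun Δ hΔ hsc => ?_⟩
  · obtain ⟨hi, he⟩ := NoisyGD.integrable_and_integral_outputLaw h σsq
      (NoisyGD.lipschitzRate C L n σsq) D hθ₁ (NoisyGD.empiricalRisk loss D θs)
    refine ⟨hi, he.trans_le ?_⟩
    exact NoisyGD.expectedRisk_lipschitzRate_le_of_variance h hn hεδ hσ hσK D hθ₁ hθs
  · obtain ⟨hi, he⟩ := NoisyGD.integrable_and_integral_outputLaw h σsq
      (NoisyGD.stronglyConvexRate Δ n) D hθ₁ (NoisyGD.empiricalRisk loss D θs)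
    refine ⟨hi, he.trans_le ?_⟩
    exact NoisyGD.expectedRisk_stronglyConvexRate_le_of_variance h hn hεδ hσ hσK hΔ hsc D hθ₁ hθs
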